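/- **Setting.** Let $k\ge 1$ and let $n$ be a power of $2$ with $\log_2 n$ even. Consider graphs on $k$ disjoint blocks $V_1,\dots,V_k$ of $n$ vertices each, where the vertices of a block are identified with the strings in $\{0,1\}^{\log_2 n}$. The distribution $\mathcal G(n,p,k)$ is obtained by including each pair of the $nk$ vertices as an edge independently with probability $p$, and then deleting all edges inside blocks. The block binary clique formula of $G$ has variables $x_{i,a}$ ($i\in[k]$, $a\in[\log_2 n]$) and, for all $i\ne j$, $u\in V_i$, $v\in V_j$ with $\{u,v\}\notin E(G)$, the clause $\bigvee_a (x_{i,a}\ne u_a)\vee\bigvee_a (x_{j,a}\ne v_a)$. In the search problem $S_G$, Alice receives the first half and Bob the second half of the bits $x_{i,1},\dots,x_{i,\log_2 n}$ for every $i\in[k]$, and they have to output a clause of the formula that is falsified by the joint assignment. A randomized (public coin) protocol is a probability distribution over deterministic protocols (binary trees in which at each internal node one of the players speaks a bit that depends on the node and on that player's input, and whose leaves are labelled by clauses of the formula). It solves $S_G$ with success probability $\delta$ if on every input its output is a falsified clause with probability at least $\delta$. Its cost is the maximum number of bits communicated, over all inputs and all deterministic protocols in the distribution. **Theorem.** 1.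 For every constant $\delta>0$ there is a constant $c>0$ such that, for all $k\ge1$ and $p\in[0,1]$ (which may depend on $n$), if $\boldsymbol G\sim\mathcal G(n,p,k)$, then asymptotically almost surely every randomized protocol that solves $S_{\boldsymbol G}$ with success probability $\delta$ has cost at least $$c\cdot\min\left(\frac{1}{\sqrt{n^{0.05}(1-p)}},\ \frac{n^{0.225}}{\log(kn)}\right),$$ where the first term is $+\infty$ if $p=1$. Here "asymptotically almost surely" means with probability $1-o(1)$ as $n\to\infty$, where the $o(1)$ term depends on $\delta$ and $n$ but not on $k$ and $p$. 2. In particular, for $k=n$ and $p=1-n^{-1/3}$, the graph $\boldsymbol G$ has $N=n^2$ vertices, and there is an absolute constant $\gamma>0$ such that, for every constant $\delta>0$, asymptotically almost surely every randomized protocol that solves $S_{\boldsymbol G}$ with success probability $\delta$ has cost at least $N^{\gamma}$. -/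

import Mathlib

open scoped ENNReal
open MeasureTheory Filter

noncomputable section

namespace CliqueComm

/-! ### CNF formulas and the falsified clause search problem -/

/-- A literal over the variables `V`: `(v, true)` is the variable `v`, and `(v, false)` is its
negation. -/
abbrev Literal (V : Type) := V × Bool

/-- A clause is a finite disjunction of literals. -/
abbrev Clause (V : Type) := Finset (Literal V)

/-- A CNF formula, given by its set of clauses. -/
abbrev CNF (V : Type) := Set (Clause V)

/-- The literal `(v ≠ b)`: it is `v` for `b = 0` and the negation of `v` for `b = 1`. -/
def neLit {V : Type} (v : V) (b : Bool) : Literal V := (v, !b)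

/-- The clause `C` is falsified by the assignment `α`: all of its literals are false. -/
def Clause.Falsified {V : Type} (C : Clause V) (α : V → Bool) : Prop :=
  ∀ l ∈ C, α l.1 ≠ l.2

/-! ### The block binary encoding of the clique formula -/

/-- The vertices of a graph with `k` blocks of size `n = 2 ^ m`: a vertex is a block together with
the binary representation of its number inside of the block, a string of `m = log n` bits. -/
abbrev BlockVertex (k m : ℕ) := Fin k × (Fin m → Bool)

/-- The variables `x_{i,a}` of the block binary clique formula. -/
abbrev BlockVar (k m : ℕ) := Fin k × Fin m

/-- The edge axiom of a pair of vertices `u`, `v` (from distinct blocks):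
`⋁ₐ (x_{i,a} ≠ uₐ) ∨ ⋁ₐ (x_{j,a} ≠ vₐ)`, where `i` and `j` are the blocks of `u` and `v`. -/
def edgeAxiom {k m : ℕ} (u v : BlockVertex k m) : Clause (BlockVar k m) :=
  (Finset.univ.image fun a : Fin m => neLit (u.1, a) (u.2 a)) ∪
    (Finset.univ.image fun a : Fin m => neLit (v.1, a) (v.2 a))

/-- The block binary clique formula of `G`: the edge axioms of all the pairs of vertices from
distinct blocks that are not joined by an edge of `G`. -/
def blockCliqueFormula {k m : ℕ} (G : SimpleGraph (BlockVertex k m)) : CNF (BlockVar k m) :=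
  {C | ∃ u v : BlockVertex k m, u.1 ≠ v.1 ∧ ¬ G.Adj u v ∧ C = edgeAxiom u v}

/-! ### Communication protocols -/

/-- Deterministic two-party protocols, as binary trees: at every internal node, Alice (who sees
`x : X`) or Bob (who sees `y : Y`) speaks one bit, which determines the child to move to; every
leaf is labelled by an output. -/
inductive Protocol (X Y O : Type) : Type
  | leaf (o : O) : Protocol X Y O
  | alice (bit : X → Bool) (ifFalse ifTrue : Protocol X Y O) : Protocol X Y O
  | bob (bit : Y → Bool) (ifFalse ifTrue : Protocol X Y O) : Protocol X Y O

namespace Protocol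

variable {X Y O : Type}

/-- The output of the protocol on the input `(x, y)`. -/
def output : Protocol X Y O → X → Y → O
  | leaf o, _, _ => o
  | alice bit P Q, x, y => if bit x then Q.output x y else P.output x y
  | bob bit P Q, x, y => if bit y then Q.output x y else P.output x y

/-- The number of bits communicated on the input `(x, y)`. -/
def bits : Protocol X Y O → X → Y → ℕ
  | leaf _, _, _ => 0
  | alice bit P Q, x, y => (if bit x then Q.bits x y else P.bits x y) + 1
  | bob bit P Q, x, y => (if bit y then Q.bits x y else P.bits x y) + 1

/-- The cost of a deterministic protocol: the maximum, over all the inputs, of the number of bits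
communicated. -/
def cost (P : Protocol X Y O) : ℕ∞ := ⨆ (x : X) (y : Y), (P.bits x y : ℕ∞)

end Protocol

/-- A randomized (public coin) protocol: a probability distribution over deterministic protocols.
There are only countably many deterministic protocols when the sets of inputs and of outputs are
finite, so that a mass function is no restriction. -/
abbrev RandomizedProtocol (X Y O : Type) := PMF (Protocol X Y O)

namespace RandomizedProtocol

variable {X Y O : Type}

/-- The cost of a randomized protocol: the maximum cost among the deterministic protocols in the
distribution. -/
def cost (R : RandomizedProtocol X Y O) : ℕ∞ := ⨆ P ∈ R.support, P.cost

/-- `R` solves the search problem `S` with success probability at least `δ`: on every input, its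
output is correct with probability at least `δ`. -/
def Solves (R : RandomizedProtocol X Y O) (S : X → Y → O → Prop) (δ : ℝ) : Prop :=
  ∀ (x : X) (y : Y), ENNReal.ofReal δ ≤ R.toOuterMeasure {P | S x y (P.output x y)}

end RandomizedProtocol

/-! ### The communication version of the search problem -/

/-- The inputs of each of the two players, when blocks have size `n = 2 ^ (t + t)`: half of the
bits, that is `t = log n / 2` bits, of each of the `k` clique members. -/
abbrev HalfInput (k t : ℕ) := Fin k → Fin t → Bool

/-- The assignment that is described by the inputs of the players: the first half of the bits of
every clique member comes from Alice and the second half from Bob. -/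
def joinInputs {k t : ℕ} (x y : HalfInput k t) : BlockVar k (t + t) → Bool :=
  fun v => Fin.append (x v.1) (y v.1) v.2

/-- The search problem: given `x` and `y`, find a clause of the block binary clique formula of `G`
that is falsified by the assignment that `x` and `y` describe. -/
def cliqueSearch {k t : ℕ} (G : SimpleGraph (BlockVertex k (t + t))) :
    HalfInput k t → HalfInput k t → blockCliqueFormula G → Prop :=
  fun x y C => Clause.Falsified C.1 (joinInputs x y)

/-- Every randomized protocol that solves the search problem of `G` with success probability at
least `δ` has cost at least `b`. -/
def CliqueSearchCostAtLeast {k t : ℕ} (G : SimpleGraph (BlockVertex k (t + t))) (δ : ℝ)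
    (b : ℝ≥0∞) : Prop :=
  ∀ R : RandomizedProtocol (HalfInput k t) (HalfInput k t) (blockCliqueFormula G),
    R.Solves (cliqueSearch G) δ → b ≤ (R.cost : ℝ≥0∞)

/-! ### Random graphs -/

/-- The complete `k`-partite graph on `k` blocks of size `2 ^ m`. -/
def completeBlockGraph (k m : ℕ) : SimpleGraph (BlockVertex k m) :=
  (⊤ : SimpleGraph (Fin k)).comap Prod.fst

/-- The distribution `𝒢(n, p, k)` for `n = 2 ^ m`: sample a graph on the `n * k` vertices, each
edge being present with probability `p` independently of the others, and intersect it with the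
complete `k`-partite graph. -/
def blockRandomGraph (k m : ℕ) (p : unitInterval) : Measure (SimpleGraph (BlockVertex k m)) :=
  (SimpleGraph.binomialRandom (BlockVertex k m) p).map fun G => G ⊓ completeBlockGraph k m

end CliqueComm

end

noncomputable section

namespace CliqueComm

set_option linter.unusedSectionVars false

/-! ### Deficits of sets of inputs -/

section Deficit

variable {K B : Type} [Fintype K] [DecidableEq K] [Fintype B] [DecidableEq B]

/-! By averaging over uniformly random inputs it suffices to bound the success of deterministic
protocols. The bound comes from a density restoring argument along the protocol tree. Each rectangle
`X × Y` carries sets `A`, `C` of blocks on which its sides are constant. It is kept light: outside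
these sets no partial assignment to `m` blocks has probability above `h ^ m`, where `h` is slightly
above the uniform probability of a half-vertex.

`potential` charges a rectangle for the expected number of non-edges among blocks in `A ∪ C`, for
`β` times the entropy deficits, for `|A ∪ C| / s`, and for a guessing probability `η = h`. Three
facts bound the success by the potential plus `β log 2` per bit. At a leaf, a claimed non-edge
either lies within `A`, and is counted by the pair weight, or needs a half-vertex that light Alice
hits with probability at most `h` (`IsClaim.sum_le_potential`). A bit raises the total deficit by at
most `log 2` per input (`deficit_filter_add_le`). Restoring lightness by fixing an overly likely
partial assignment on `S` lowers the deficit by `|S| L` per input of the fixed part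
(`deficit_agreeing_add_le`), and this pays for the new non-edges and the growth of `A ∪ C`
(`sum_le_potential_of_light`).

A newly fixed half-vertex creates few non-edges because the other player's side is light and every
row and column of the random graph contains few non-neighbours of each vertex in another block
(`blockRandomGraph_rowBounded`). The full rectangle has potential `h` per input pair, so success is
at most `h + β log 2 · d` for `d` bits. -/

/-- The inputs in `X` that agree with `v` on the coordinates in `S`. -/
def agreeing (X : Finset (K → B)) (S : Finset K) (v : K → B) : Finset (K → B) :=
  X.filter fun x => ∀ i ∈ S, x i = v i

/-- All the inputs in `X` agree on the coordinates in `A`. -/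
def IsFixed (X : Finset (K → B)) (A : Finset K) : Prop :=
  ∃ v : K → B, ∀ x ∈ X, ∀ i ∈ A, x i = v i

/-- Outside of `A`, no partial assignment is too likely for a uniformly random input from `X`. -/
def IsLight (h : ℝ) (X : Finset (K → B)) (A : Finset K) : Prop :=
  ∀ S : Finset K, Disjoint S A → ∀ v : K → B,
    ((agreeing X S v).card : ℝ) ≤ h ^ S.card * X.card

/-- The entropy deficit of the uniform distribution on `X` with respect to the coordinates outside
of `A`, multiplied by the number of elements of `X`. -/
def deficit (X : Finset (K → B)) (A : Finset K) : ℝ :=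
  X.card * (((Fintype.card K : ℝ) - A.card) * Real.log (Fintype.card B) - Real.log X.card)

lemma IsFixed.subset {X X' : Finset (K → B)} {A : Finset K} (h : IsFixed X A) (hX : X' ⊆ X) :
    IsFixed X' A := by
  obtain ⟨v, hv⟩ := h
  exact ⟨v, fun x hx => hv x (hX hx)⟩

lemma IsFixed.agreeing {X : Finset (K → B)} {A : Finset K} (h : IsFixed X A) (S : Finset K)
    (w : K → B) : IsFixed (agreeing X S w) (A ∪ S) := by
  obtain ⟨v, hv⟩ := h
  refine ⟨fun i => if i ∈ S then w i else v i, fun x hx i hi => ?_⟩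
  rw [CliqueComm.agreeing, Finset.mem_filter] at hx
  by_cases hS : i ∈ S
  · simpa [hS] using hx.2 i hS
  · have hA : i ∈ A := by simpa [hS] using hi
    simpa [hS] using hv x hx.1 i hA

lemma IsFixed.card_le {X : Finset (K → B)} {A : Finset K} (h : IsFixed X A) :
    X.card ≤ Fintype.card B ^ (Fintype.card K - A.card) := by
  obtain ⟨v, hv⟩ := h
  have : X.card ≤ (Finset.univ : Finset ((Aᶜ : Finset K) → B)).card := by
    refine Finset.card_le_card_of_injOn (fun x i => x i) (by simp) ?_
    intro x hx y hy hxy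
    funext i
    by_cases hi : i ∈ A
    · rw [hv x hx i hi, hv y hy i hi]
    · exact congrFun hxy ⟨i, by simpa using hi⟩
  simpa [Finset.card_compl] using this

lemma IsFixed.deficit_nonneg {X : Finset (K → B)} {A : Finset K} (h : IsFixed X A) :
    0 ≤ deficit X A := by
  rcases Finset.eq_empty_or_nonempty X with rfl | hX
  · simp [deficit]
  have h1 : (X.card : ℝ) ≤ (Fintype.card B : ℝ) ^ (Fintype.card K - A.card) := by
    exact_mod_cast h.card_le
  have h0 : (0 : ℝ) < X.card := by exact_mod_cast hX.card_pos
  have h2 := Real.log_le_log h0 h1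
  rw [Real.log_pow, Nat.cast_sub (Finset.card_le_univ A)] at h2
  exact mul_nonneg h0.le (by linarith)

/-- Midpoint concavity of `-x log x`: unnormalized form of the fact that a bit has entropy at most
`log 2`. -/
lemma add_log_two_le {a b : ℝ} (ha : 0 ≤ a) (hb : 0 ≤ b) :
    Real.negMulLog a + Real.negMulLog b ≤ Real.negMulLog (a + b) + (a + b) * Real.log 2 := by
  have h := Real.concaveOn_negMulLog.2 (Set.mem_Ici.2 ha) (Set.mem_Ici.2 hb)
    (by norm_num : (0 : ℝ) ≤ 1 / 2) (by norm_num : (0 : ℝ) ≤ 1 / 2) (by norm_num)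
  simp only [smul_eq_mul] at h
  have h2 : (1 / 2 : ℝ) * a + 1 / 2 * b = (a + b) / 2 := by ring
  rw [h2] at h
  rcases (add_nonneg ha hb).eq_or_lt with h0 | h0
  · obtain rfl : a = 0 := by linarith
    obtain rfl : b = 0 := by linarith
    simp
  · rw [Real.negMulLog, Real.negMulLog, Real.negMulLog, Real.log_div h0.ne' (by norm_num)] at h
    rw [Real.negMulLog, Real.negMulLog, Real.negMulLog]
    linarith

/-- Because `deficit` is weighted by cardinality, the terms linear in the size are additive and only
the entropy of the split remains. -/
lemma deficit_filter_add_le (X : Finset (K → B)) (A : Finset K) (q : (K → B) → Prop)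
    [DecidablePred q] :
    deficit (X.filter q) A + deficit (X.filter fun x => ¬ q x) A ≤
      deficit X A + X.card * Real.log 2 := by
  have hc : (X.card : ℝ) = (X.filter q).card + (X.filter fun x => ¬ q x).card := by
    exact_mod_cast (Finset.card_filter_add_card_filter_not q).symm
  have := add_log_two_le (Nat.cast_nonneg (α := ℝ) (X.filter q).card)
    (Nat.cast_nonneg (α := ℝ) (X.filter fun x => ¬ q x).card)
  simp only [deficit, hc, Real.negMulLog] at this ⊢
  linarith

/-- Fixing `S` removes `|S| log |B|` from the maximal entropy, while the agreeing part loses at most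
`-|S| log h` of actual entropy, being overly likely. The remainder's deficit grows by at most the
size of the agreeing part. Since `S` is nonempty, the `1` in `1 + L` absorbs this loss. -/
lemma deficit_agreeing_add_le {X : Finset (K → B)} {A S : Finset K} {v : K → B} {h L : ℝ}
    (hh : 0 < h) (hL : 1 + L ≤ Real.log (Fintype.card B) + Real.log h) (hS : Disjoint S A)
    (hv : h ^ S.card * X.card < (agreeing X S v).card) (hS0 : S.Nonempty) :
    deficit (agreeing X S v) (A ∪ S) + deficit (X \ agreeing X S v) A +
      S.card * L * (agreeing X S v).card ≤ deficit X A := by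
  have hsub : agreeing X S v ⊆ X := Finset.filter_subset _ _
  have hc : (X.card : ℝ) = (agreeing X S v).card + (X \ agreeing X S v).card := by
    rw [Finset.cast_card_sdiff hsub]; ring
  have hU : ((A ∪ S).card : ℝ) = A.card + S.card := by
    rw [Finset.card_union_of_disjoint hS.symm]; push_cast; ring
  have hm : (1 : ℝ) ≤ S.card := by exact_mod_cast hS0.card_pos
  have ha : 0 < ((agreeing X S v).card : ℝ) := lt_of_le_of_lt (by positivity) hv
  have hb : 0 ≤ ((X \ agreeing X S v).card : ℝ) := Nat.cast_nonneg _
  simp only [deficit, hU]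
  rw [hc] at hv ⊢
  generalize ((agreeing X S v).card : ℝ) = a at *
  generalize ((X \ agreeing X S v).card : ℝ) = b at *
  have h1 : a * (Real.log (a + b) - Real.log a) ≤ a * (-(S.card * Real.log h)) := by
    refine mul_le_mul_of_nonneg_left ?_ ha.le
    have := Real.log_le_log (by positivity) hv.le
    rw [Real.log_mul (by positivity) (by positivity), Real.log_pow] at this
    linarith
  -- The cost of conditioning on the complement, from `log z ≤ z - 1`.
  have h2 : b * (Real.log (a + b) - Real.log b) ≤ a := by
    rcases hb.eq_or_lt with rfl | hb
    · simpa using ha.le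
    rw [← Real.log_div (by positivity) hb.ne']
    calc b * Real.log ((a + b) / b) ≤ b * ((a + b) / b - 1) :=
          mul_le_mul_of_nonneg_left (Real.log_le_sub_one_of_pos (by positivity)) hb.le
      _ = a := by field_simp; ring
  have h3 : a * (1 + S.card * (L - Real.log (Fintype.card B) - Real.log h)) ≤ 0 := by
    refine mul_nonpos_of_nonneg_of_nonpos ha.le ?_
    nlinarith
  linarith

end Deficit

/-! ### The potential of a rectangle and the density restoring argument -/

section Potential

variable {K B : Type} [Fintype K] [DecidableEq K] [Fintype B] [DecidableEq B]

/-- The total weight of the pairs of coordinates from `I` on the rectangle `X × Y`. -/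
def pairWeight (w : K → K → (K → B) → (K → B) → ℝ) (I : Finset K) (X Y : Finset (K → B)) : ℝ :=
  ∑ p ∈ I.offDiag, ∑ x ∈ X, ∑ y ∈ Y, w p.1 p.2 x y

/-- The potential of the rectangle `X × Y` whose sides are fixed on `A` and `C`, respectively. -/
def potential (w : K → K → (K → B) → (K → B) → ℝ) (β s η : ℝ) (X Y : Finset (K → B))
    (A C : Finset K) : ℝ :=
  pairWeight w (A ∪ C) X Y + β * (Y.card * deficit X A + X.card * deficit Y C) +
    X.card * Y.card * ((A ∪ C).card / s + η)

lemma pairWeight_swap (w : K → K → (K → B) → (K → B) → ℝ) (I : Finset K)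
    (X Y : Finset (K → B)) :
    pairWeight (fun i j y x => w i j x y) I Y X = pairWeight w I X Y :=
  Finset.sum_congr rfl fun _ _ => Finset.sum_comm

/-- Lets Bob's turns reuse the argument written for Alice. -/
lemma potential_swap (w : K → K → (K → B) → (K → B) → ℝ) (β s η : ℝ) (X Y : Finset (K → B))
    (A C : Finset K) :
    potential (fun i j y x => w i j x y) β s η Y X C A = potential w β s η X Y A C := by
  rw [potential, potential, pairWeight_swap, Finset.union_comm C A]
  ring

lemma pairWeight_nonneg {w : K → K → (K → B) → (K → B) → ℝ} (hw : ∀ i j x y, 0 ≤ w i j x y)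
    (I : Finset K) (X Y : Finset (K → B)) : 0 ≤ pairWeight w I X Y :=
  Finset.sum_nonneg fun _ _ => Finset.sum_nonneg fun _ _ => Finset.sum_nonneg fun _ _ =>
    hw _ _ _ _

lemma pairWeight_disjUnion {w : K → K → (K → B) → (K → B) → ℝ} {X X₁ X₂ : Finset (K → B)}
    (hX : ∀ f : (K → B) → ℝ, ∑ x ∈ X, f x = ∑ x ∈ X₁, f x + ∑ x ∈ X₂, f x)
    (I : Finset K) (Y : Finset (K → B)) :
    pairWeight w I X Y = pairWeight w I X₁ Y + pairWeight w I X₂ Y := by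
  simp only [pairWeight, hX, Finset.sum_add_distrib]

/-- Every new pair has a coordinate outside `I`, hence outside `C`, so its average weight over `Y`
is at most `τ` for each `x`. -/
lemma pairWeight_union_le {w : K → K → (K → B) → (K → B) → ℝ} {τ : ℝ} (hτ0 : 0 ≤ τ)
    {C : Finset K} {Y : Finset (K → B)}
    (hτ : ∀ i j, i ≠ j → i ∉ C → ∀ x, ∑ y ∈ Y, w i j x y ≤ τ * Y.card ∧
      ∑ y ∈ Y, w j i x y ≤ τ * Y.card)
    {I : Finset K} (hI : C ⊆ I) (S : Finset K) (X : Finset (K → B)) :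
    pairWeight w (I ∪ S) X Y ≤
      pairWeight w I X Y + 2 * S.card * (I ∪ S).card * (τ * (X.card * Y.card)) := by
  have hsub : I.offDiag ⊆ (I ∪ S).offDiag := Finset.offDiag_mono Finset.subset_union_left
  have hnew : ∀ p ∈ (I ∪ S).offDiag \ I.offDiag,
      ∑ x ∈ X, ∑ y ∈ Y, w p.1 p.2 x y ≤ τ * (X.card * Y.card) := by
    rintro ⟨i, j⟩ hp
    simp only [Finset.mem_sdiff, Finset.mem_offDiag] at hp
    have hx : ∀ x ∈ X, ∑ y ∈ Y, w i j x y ≤ τ * Y.card := by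
      intro x _
      by_cases hi : i ∈ C
      · have hj : j ∉ C := fun hj => hp.2 ⟨hI hi, hI hj, hp.1.2.2⟩
        exact (hτ j i (Ne.symm hp.1.2.2) hj x).2
      · exact (hτ i j hp.1.2.2 hi x).1
    calc _ ≤ ∑ x ∈ X, τ * (Y.card : ℝ) := Finset.sum_le_sum hx
      _ = τ * (X.card * Y.card) := by rw [Finset.sum_const, nsmul_eq_mul]; ring
  have hcard : ((I ∪ S).offDiag \ I.offDiag).card ≤ 2 * S.card * (I ∪ S).card := by
    have : (I ∪ S).offDiag \ I.offDiag ⊆ S ×ˢ (I ∪ S) ∪ (I ∪ S) ×ˢ S := by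
      intro p hp
      simp only [Finset.mem_sdiff, Finset.mem_offDiag, Finset.mem_union, Finset.mem_product] at hp ⊢
      tauto
    refine (Finset.card_le_card this).trans ((Finset.card_union_le _ _).trans ?_)
    rw [Finset.card_product, Finset.card_product]
    apply le_of_eq; ring
  rw [pairWeight, ← Finset.sum_sdiff hsub, add_comm, ← pairWeight]
  gcongr
  refine (Finset.sum_le_card_nsmul _ _ _ hnew).trans ?_
  rw [nsmul_eq_mul]
  refine mul_le_mul_of_nonneg_right ?_ (by positivity)
  exact_mod_cast hcard

lemma potential_nonneg {w : K → K → (K → B) → (K → B) → ℝ} (hw : ∀ i j x y, 0 ≤ w i j x y)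
    {β s η : ℝ} (hβ : 0 ≤ β) (hs : 0 < s) (hη : 0 ≤ η) {X Y : Finset (K → B)} {A C : Finset K}
    (hX : IsFixed X A) (hY : IsFixed Y C) : 0 ≤ potential w β s η X Y A C := by
  have := pairWeight_nonneg hw (A ∪ C) X Y
  have := hX.deficit_nonneg
  have := hY.deficit_nonneg
  unfold potential
  positivity

/-- If a bound by the potential holds whenever Alice's side is light, then it always holds. -/
theorem sum_le_potential_of_light {w : K → K → (K → B) → (K → B) → ℝ}
    {β s η τ h L : ℝ} (hw : ∀ i j x y, 0 ≤ w i j x y) (hβ : 0 ≤ β) (hs : 0 < s) (hη : 0 ≤ η)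
    (hτ0 : 0 ≤ τ) (hh : 0 < h) (hL : 1 + L ≤ Real.log (Fintype.card B) + Real.log h)
    (hβL : β * L = 2 * s * τ + 1 / s)
    {g : (K → B) → (K → B) → ℝ} (hg : ∀ x y, g x y ≤ 1)
    {Y : Finset (K → B)} {C : Finset K} (hY : IsFixed Y C)
    (hτ : ∀ i j, i ≠ j → i ∉ C → ∀ x, ∑ y ∈ Y, w i j x y ≤ τ * Y.card ∧
      ∑ y ∈ Y, w j i x y ≤ τ * Y.card)
    (H : ∀ X A, IsFixed X A → IsLight h X A →
      ∑ x ∈ X, ∑ y ∈ Y, g x y ≤ potential w β s η X Y A C) :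
    ∀ X A, IsFixed X A → ∑ x ∈ X, ∑ y ∈ Y, g x y ≤ potential w β s η X Y A C := by
  -- The agreeing part may be all of `X`, so the measure must also count the free coordinates, which
  -- decrease there.
  suffices ∀ (n : ℕ) (X : Finset (K → B)) (A : Finset K), X.card + Aᶜ.card ≤ n → IsFixed X A →
      ∑ x ∈ X, ∑ y ∈ Y, g x y ≤ potential w β s η X Y A C from
    fun X A => this _ X A le_rfl
  intro n
  induction n with
  | zero =>
    intro X A hn hX
    obtain rfl : X = ∅ := Finset.card_eq_zero.1 (by omega)
    simpa using potential_nonneg hw hβ hs hη hX hY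
  | succ n ih =>
    intro X A hn hX
    by_cases hlight : IsLight h X A
    · exact H X A hX hlight
    simp only [IsLight, not_forall, not_le] at hlight
    obtain ⟨S, hS, v, hv⟩ := hlight
    have hS0 : S.Nonempty := by
      rw [Finset.nonempty_iff_ne_empty]
      rintro rfl
      simp [agreeing] at hv
    set X₁ := agreeing X S v with hX₁
    have hsub : X₁ ⊆ X := Finset.filter_subset _ _
    have hX₁0 : 0 < X₁.card := by
      have : (0 : ℝ) < X₁.card := lt_of_le_of_lt (by positivity) hv
      exact_mod_cast this
    have hsum : ∀ f : (K → B) → ℝ, ∑ x ∈ X, f x = ∑ x ∈ X₁, f x + ∑ x ∈ X \ X₁, f x := by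
      intro f
      rw [add_comm, Finset.sum_sdiff hsub]
    have h2 := ih (X \ X₁) A (by
      have := Finset.card_sdiff_add_card_eq_card hsub
      omega) (hX.subset Finset.sdiff_subset)
    have hfix := hX.agreeing S v
    have hA : (A ∪ S)ᶜ.card < Aᶜ.card := by
      have h1 : (A ∪ S).card = A.card + S.card := Finset.card_union_of_disjoint hS.symm
      have h3 := Finset.card_compl_add_card (A ∪ S)
      have h4 := Finset.card_compl_add_card A
      have := hS0.card_pos
      omega
    have h1 := ih X₁ (A ∪ S) (by have := Finset.card_le_card hsub; omega) hfix
    have hdef := deficit_agreeing_add_le hh hL hS hv hS0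
    rw [← hX₁] at hdef
    have hcard : (X.card : ℝ) = X₁.card + (X \ X₁).card := by simpa using hsum fun _ => 1
    have hpw := pairWeight_disjUnion (w := w) hsum (A ∪ C) Y
    have hU : A ∪ S ∪ C = A ∪ C ∪ S := by
      rw [Finset.union_assoc, Finset.union_comm S C, Finset.union_assoc]
    have hUcard : ((A ∪ C ∪ S).card : ℝ) ≤ (A ∪ C).card + S.card := by
      exact_mod_cast Finset.card_union_le _ _
    -- The last summand is the price of fixing `S`. By the choice of `β` it equals `β` times the
    -- deficit released.
    have key : ∑ x ∈ X₁, ∑ y ∈ Y, g x y ≤ pairWeight w (A ∪ C) X₁ Y +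
        β * (Y.card * deficit X₁ (A ∪ S) + X₁.card * deficit Y C) +
        X₁.card * Y.card * ((A ∪ C).card / s + η) +
        X₁.card * Y.card * (S.card * (2 * s * τ + 1 / s)) := by
      have hfd := hfix.deficit_nonneg
      have hYd := hY.deficit_nonneg
      have hpn := pairWeight_nonneg hw (A ∪ C) X₁ Y
      have hdiv : ((A ∪ C ∪ S).card : ℝ) / s ≤ (A ∪ C).card / s + S.card * (1 / s) := by
        rw [mul_one_div, ← add_div]; gcongr
      -- Once `s` blocks are fixed, the term `|A ∪ C ∪ S| / s` already exceeds the trivial bound `1`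
      -- on the value. Otherwise fewer than `s` blocks are fixed, and `S` creates at most `2 |S| s`
      -- new pairs.
      rcases le_or_gt s ((A ∪ C ∪ S).card : ℝ) with hbig | hsmall
      · have htriv : ∑ x ∈ X₁, ∑ y ∈ Y, g x y ≤ X₁.card * Y.card := by
          calc _ ≤ ∑ x ∈ X₁, ∑ y ∈ Y, (1 : ℝ) :=
                Finset.sum_le_sum fun x _ => Finset.sum_le_sum fun y _ => hg x y
            _ = _ := by simp
        have h1s : 1 ≤ ((A ∪ C ∪ S).card : ℝ) / s := (one_le_div hs).2 hbig
        have hsτ : 0 ≤ S.card * (2 * s * τ) := by positivity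
        have hXY : (0 : ℝ) ≤ X₁.card * Y.card := by positivity
        have h5 : (X₁.card * Y.card : ℝ) * 1 ≤ X₁.card * Y.card *
            ((A ∪ C).card / s + η + S.card * (2 * s * τ + 1 / s)) :=
          mul_le_mul_of_nonneg_left (by linarith) hXY
        have h6 : 0 ≤ β * (Y.card * deficit X₁ (A ∪ S) + X₁.card * deficit Y C) := by
          positivity
        linarith
      · have hgrow := pairWeight_union_le hτ0 hτ (Finset.subset_union_right (s₁ := A)) S X₁
        rw [potential, hU] at h1
        have hXY : (0 : ℝ) ≤ X₁.card * Y.card := by positivity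
        have h5 : 2 * (S.card : ℝ) * (A ∪ C ∪ S).card * (τ * (X₁.card * Y.card)) ≤
            2 * (S.card : ℝ) * s * (τ * (X₁.card * Y.card)) := by gcongr
        have h6 := mul_le_mul_of_nonneg_left (add_le_add_left hdiv η) hXY
        linarith
    have hdefY := mul_le_mul_of_nonneg_left hdef
      (mul_nonneg hβ (Nat.cast_nonneg (α := ℝ) Y.card))
    have hβ' : β * Y.card * (S.card * L * X₁.card) =
        X₁.card * Y.card * (S.card * (2 * s * τ + 1 / s)) := by
      rw [← hβL]; ring
    rw [hsum]
    simp only [potential] at h2 ⊢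
    rw [hpw, hcard]
    rw [mul_add, mul_add, hβ'] at hdefY
    linarith

end Potential

/-! ### Protocols that search for a pair of related vertices -/

section Search

variable {K B : Type} [Fintype K] [DecidableEq K] [Fintype B] [DecidableEq B]

open scoped Classical in
/-- The indicator of the event that the vertices of the blocks `i` and `j` are related. -/
def relWeight (r : K × B × B → K × B × B → Prop) (i j : K) (x y : K → B) : ℝ :=
  if r (i, x i, y i) (j, x j, y j) then 1 else 0

lemma relWeight_nonneg (r : K × B × B → K × B × B → Prop) (i j : K) (x y : K → B) :
    0 ≤ relWeight r i j x y := by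
  unfold relWeight; split_ifs <;> norm_num

lemma relWeight_comm {r : K × B × B → K × B × B → Prop} (hr : ∀ u v, r u v → r v u)
    (i j : K) (x y : K → B) : relWeight r i j x y = relWeight r j i x y := by
  unfold relWeight
  congr 1
  exact propext ⟨hr _ _, hr _ _⟩

open scoped Classical in
/-- In every row of another block, every vertex is related to at most `T` vertices. -/
def RowBounded (r : K × B × B → K × B × B → Prop) (T : ℝ) : Prop :=
  ∀ i j, i ≠ j → ∀ (a : B) (u : B × B),
    ((Finset.univ.filter fun b => r (i, a, b) (j, u)).card : ℝ) ≤ T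

/-- The relation in which the two halves of the vertices are exchanged. -/
def swapRel (r : K × B × B → K × B × B → Prop) : K × B × B → K × B × B → Prop :=
  fun u v => r (u.1, u.2.swap) (v.1, v.2.swap)

lemma IsLight.card_filter_le {h : ℝ} {Y : Finset (K → B)} {C : Finset K} (hY : IsLight h Y C)
    {i : K} (hi : i ∉ C) (b : B) : ((Y.filter fun y => y i = b).card : ℝ) ≤ h * Y.card := by
  simpa [agreeing] using hY {i} (by simpa using hi) fun _ => b

lemma IsLight.card_filter_pair_le {h : ℝ} {Y : Finset (K → B)} {C : Finset K}
    (hY : IsLight h Y C) {i j : K} (hij : i ≠ j) (hi : i ∉ C) (hj : j ∉ C) (b b' : B) :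
    ((Y.filter fun y => y i = b ∧ y j = b').card : ℝ) ≤ h ^ 2 * Y.card := by
  have := hY {i, j} (by simp [hi, hj]) fun l => if l = i then b else b'
  simpa [agreeing, Finset.card_pair hij, hij.symm] using this

/-- For fixed `x` and `y j`, at most `T` values of `y i` produce a related pair. If `j ∈ C`, then `y
j` is constant and each value has probability at most `h`. Otherwise a union bound over the `|B|`
values of `y j` uses the bound `h ^ 2` for pairs. -/
lemma sum_relWeight_le {r : K × B × B → K × B × B → Prop} {T h : ℝ} (hr : RowBounded r T)
    (hT : 0 ≤ T) (hh : 0 ≤ h) (hhB : 1 ≤ Fintype.card B * h) {Y : Finset (K → B)} {C : Finset K}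
    (hfix : IsFixed Y C) (hlight : IsLight h Y C) {i j : K} (hij : i ≠ j) (hi : i ∉ C)
    (x : K → B) : ∑ y ∈ Y, relWeight r i j x y ≤ T * (Fintype.card B * h) * h * Y.card := by
  classical
  have hsum : ∑ y ∈ Y, relWeight r i j x y =
      ((Y.filter fun y => r (i, x i, y i) (j, x j, y j)).card : ℝ) := by
    simp only [relWeight, Finset.sum_boole]
  rw [hsum]
  by_cases hj : j ∈ C
  · obtain ⟨v, hv⟩ := hfix
    have hsub : (Y.filter fun y => r (i, x i, y i) (j, x j, y j)) ⊆
        (Finset.univ.filter fun b => r (i, x i, b) (j, x j, v j)).biUnion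
          fun b => Y.filter fun y => y i = b := by
      intro y hy
      simp only [Finset.mem_filter] at hy
      simp only [Finset.mem_biUnion, Finset.mem_filter, Finset.mem_univ, true_and]
      exact ⟨y i, by rw [← hv y hy.1 j hj]; exact hy.2, hy.1, rfl⟩
    calc ((Y.filter fun y => r (i, x i, y i) (j, x j, y j)).card : ℝ)
        ≤ ∑ b ∈ Finset.univ.filter fun b => r (i, x i, b) (j, x j, v j),
            ((Y.filter fun y => y i = b).card : ℝ) := by
          exact_mod_cast (Finset.card_le_card hsub).trans Finset.card_biUnion_le
      _ ≤ ∑ b ∈ Finset.univ.filter fun b => r (i, x i, b) (j, x j, v j), h * Y.card :=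
          Finset.sum_le_sum fun b _ => hlight.card_filter_le hi b
      _ = ((Finset.univ.filter fun b => r (i, x i, b) (j, x j, v j)).card : ℝ) *
            (h * Y.card) := by rw [Finset.sum_const, nsmul_eq_mul]
      _ ≤ T * (h * Y.card) := mul_le_mul_of_nonneg_right (hr i j hij _ _) (by positivity)
      _ = T * 1 * h * Y.card := by ring
      _ ≤ T * (Fintype.card B * h) * h * Y.card := by gcongr
  · have hsub : (Y.filter fun y => r (i, x i, y i) (j, x j, y j)) ⊆
        Finset.univ.biUnion fun b' =>
          (Finset.univ.filter fun b => r (i, x i, b) (j, x j, b')).biUnion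
            fun b => Y.filter fun y => y i = b ∧ y j = b' := by
      intro y hy
      simp only [Finset.mem_filter] at hy
      simp only [Finset.mem_biUnion, Finset.mem_filter, Finset.mem_univ, true_and]
      exact ⟨y j, y i, hy.2, hy.1, rfl, rfl⟩
    calc ((Y.filter fun y => r (i, x i, y i) (j, x j, y j)).card : ℝ)
        ≤ ∑ b' : B, ∑ b ∈ Finset.univ.filter fun b => r (i, x i, b) (j, x j, b'),
            ((Y.filter fun y => y i = b ∧ y j = b').card : ℝ) := by
          exact_mod_cast (Finset.card_le_card hsub).trans (Finset.card_biUnion_le.trans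
            (Finset.sum_le_sum fun _ _ => Finset.card_biUnion_le))
      _ ≤ ∑ b' : B, T * (h ^ 2 * Y.card) := by
          refine Finset.sum_le_sum fun b' _ => ?_
          calc _ ≤ ∑ b ∈ Finset.univ.filter fun b => r (i, x i, b) (j, x j, b'),
                  h ^ 2 * (Y.card : ℝ) :=
                Finset.sum_le_sum fun b _ => hlight.card_filter_pair_le hij hi hj b b'
            _ = ((Finset.univ.filter fun b => r (i, x i, b) (j, x j, b')).card : ℝ) *
                  (h ^ 2 * Y.card) := by rw [Finset.sum_const, nsmul_eq_mul]
            _ ≤ T * (h ^ 2 * Y.card) :=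
                mul_le_mul_of_nonneg_right (hr i j hij _ _) (by positivity)
      _ = T * (Fintype.card B * h) * h * Y.card := by
          rw [Finset.sum_const, nsmul_eq_mul, Finset.card_univ]; ring

/-- The value of an output that claims that two given vertices are related is positive only on the
inputs on which these two vertices are selected. -/
def IsClaim (r : K × B × B → K × B × B → Prop) (f : (K → B) → (K → B) → ℝ) : Prop :=
  (∀ x y, 0 ≤ f x y ∧ f x y ≤ 1) ∧
    ∃ u v : K × B × B, u.1 ≠ v.1 ∧ r u v ∧ ∀ x y, f x y ≠ 0 →
      (u.1, x u.1, y u.1) = u ∧ (v.1, x v.1, y v.1) = v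

lemma IsLight.sum_le_of_support {h : ℝ} {X Y : Finset (K → B)} {A : Finset K}
    (hX : IsLight h X A) {f : (K → B) → (K → B) → ℝ} (hf : ∀ x y, f x y ≤ 1) {i : K} (hi : i ∉ A)
    {a : B} (hfi : ∀ x y, f x y ≠ 0 → x i = a) :
    ∑ x ∈ X, ∑ y ∈ Y, f x y ≤ X.card * Y.card * h := by
  calc ∑ x ∈ X, ∑ y ∈ Y, f x y = ∑ x ∈ X.filter fun x => x i = a, ∑ y ∈ Y, f x y := by
        refine (Finset.sum_filter_of_ne fun x _ hx => ?_).symm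
        obtain ⟨y, _, hy⟩ := Finset.exists_ne_zero_of_sum_ne_zero hx
        exact hfi x y hy
    _ ≤ ∑ x ∈ X.filter fun x => x i = a, ∑ y ∈ Y, 1 :=
        Finset.sum_le_sum fun x _ => Finset.sum_le_sum fun y _ => hf x y
    _ = ((X.filter fun x => x i = a).card : ℝ) * Y.card := by simp
    _ ≤ h * X.card * Y.card :=
        mul_le_mul_of_nonneg_right (hX.card_filter_le hi a) (by positivity)
    _ = X.card * Y.card * h := by ring

/-- If one of the claimed blocks is not fixed for Alice, her half of that vertex is correct with
probability at most `h`. If both are fixed, the claim is dominated by one summand of the pair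
weight. Lightness of Alice's side alone suffices. -/
lemma IsClaim.sum_le_potential {r : K × B × B → K × B × B → Prop} {f : (K → B) → (K → B) → ℝ}
    (hf : IsClaim r f) {β s h : ℝ} (hβ : 0 ≤ β) (hs : 0 < s) (hh : 0 ≤ h)
    {X Y : Finset (K → B)} {A C : Finset K} (hX : IsFixed X A) (hY : IsFixed Y C)
    (hXl : IsLight h X A) :
    ∑ x ∈ X, ∑ y ∈ Y, f x y ≤ potential (relWeight r) β s h X Y A C := by
  obtain ⟨hf1, ⟨i, a⟩, ⟨j, b⟩, hij, hr, hsupp⟩ := hf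
  have hXd := hX.deficit_nonneg
  have hYd := hY.deficit_nonneg
  have hpot : pairWeight (relWeight r) (A ∪ C) X Y + X.card * Y.card * h ≤
      potential (relWeight r) β s h X Y A C := by
    have h1 : 0 ≤ β * (Y.card * deficit X A + X.card * deficit Y C) := by positivity
    have h2 : 0 ≤ (X.card * Y.card : ℝ) * ((A ∪ C).card / s) := by positivity
    unfold potential
    linarith
  refine le_trans ?_ hpot
  have hXY : 0 ≤ (X.card * Y.card : ℝ) * h := by positivity
  have hpw := pairWeight_nonneg (relWeight_nonneg r) (A ∪ C) X Y
  by_cases hi : i ∈ A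
  swap
  · have := hXl.sum_le_of_support (Y := Y) (fun x y => (hf1 x y).2) hi (a := a.1)
      fun x y hxy => by simpa using congrArg (fun p => p.2.1) (hsupp x y hxy).1
    linarith
  by_cases hj : j ∈ A
  swap
  · have := hXl.sum_le_of_support (Y := Y) (fun x y => (hf1 x y).2) hj (a := b.1)
      fun x y hxy => by simpa using congrArg (fun p => p.2.1) (hsupp x y hxy).2
    linarith
  have hle : ∑ x ∈ X, ∑ y ∈ Y, f x y ≤ ∑ x ∈ X, ∑ y ∈ Y, relWeight r i j x y := by
    refine Finset.sum_le_sum fun x _ => Finset.sum_le_sum fun y _ => ?_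
    by_cases h0 : f x y = 0
    · rw [h0]; exact relWeight_nonneg r i j x y
    · obtain ⟨h1, h2⟩ := hsupp x y h0
      rw [relWeight, if_pos]
      · exact (hf1 x y).2
      · simp only at h1 h2
        rw [h1, h2]; exact hr
  have hmem : (i, j) ∈ (A ∪ C).offDiag := by
    simp [Finset.mem_offDiag, hi, hj]
    exact hij
  have := Finset.single_le_sum (f := fun p => ∑ x ∈ X, ∑ y ∈ Y, relWeight r p.1 p.2 x y)
    (fun p _ => Finset.sum_nonneg fun x _ => Finset.sum_nonneg fun y _ =>
      relWeight_nonneg r p.1 p.2 x y) hmem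
  rw [← pairWeight] at this
  simp only at this
  linarith

lemma sum_filter_add {ι : Type} (X : Finset ι) (q : ι → Prop) [DecidablePred q] (f : ι → ℝ) :
    ∑ x ∈ X, f x = ∑ x ∈ X.filter q, f x + ∑ x ∈ X.filter fun x => ¬ q x, f x :=
  (Finset.sum_filter_add_sum_filter_not X q f).symm

lemma potential_filter_add_le (w : K → K → (K → B) → (K → B) → ℝ) {β s η : ℝ} (hβ : 0 ≤ β)
    (X Y : Finset (K → B)) (A C : Finset K) (q : (K → B) → Prop) [DecidablePred q] :
    potential w β s η (X.filter q) Y A C + potential w β s η (X.filter fun x => ¬ q x) Y A C ≤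
      potential w β s η X Y A C + β * Real.log 2 * (X.card * Y.card) := by
  have hpw := pairWeight_disjUnion (w := w) (sum_filter_add X q) (A ∪ C) Y
  have hc : (X.card : ℝ) = (X.filter q).card + (X.filter fun x => ¬ q x).card := by
    exact_mod_cast (Finset.card_filter_add_card_filter_not q).symm
  have hd := mul_le_mul_of_nonneg_left (deficit_filter_add_le X A q)
    (mul_nonneg hβ (Nat.cast_nonneg (α := ℝ) Y.card))
  simp only [potential]
  rw [hpw]
  rw [hc] at hd ⊢
  linarith

/-- Alice's speaking decomposes the value of a protocol. -/
lemma sum_ite_sub_bits (X Y : Finset (K → B)) (bit : (K → B) → Bool) (c : ℝ)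
    (f₀ f₁ b₀ b₁ : (K → B) → (K → B) → ℝ) :
    ∑ x ∈ X, ∑ y ∈ Y, ((if bit x then f₁ x y else f₀ x y) -
        c * ((if bit x then b₁ x y else b₀ x y) + 1)) =
      (∑ x ∈ X.filter fun x => bit x = true, ∑ y ∈ Y, (f₁ x y - c * b₁ x y)) +
      (∑ x ∈ X.filter fun x => ¬ bit x = true, ∑ y ∈ Y, (f₀ x y - c * b₀ x y)) -
        c * (X.card * Y.card) := by
  rw [Finset.sum_filter, Finset.sum_filter, ← Finset.sum_add_distrib]
  have : c * (X.card * Y.card : ℝ) = ∑ x ∈ X, c * Y.card := by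
    rw [Finset.sum_const, nsmul_eq_mul]; ring
  rw [this, ← Finset.sum_sub_distrib]
  refine Finset.sum_congr rfl fun x _ => ?_
  have : c * (Y.card : ℝ) = ∑ y ∈ Y, c := by
    rw [Finset.sum_const, nsmul_eq_mul]; ring
  rw [this]
  cases bit x
  · simp only [Bool.false_eq_true, if_false, not_false_eq_true, if_true, zero_add]
    rw [← Finset.sum_sub_distrib]
    exact Finset.sum_congr rfl fun y _ => by ring
  · simp only [if_true, not_true_eq_false, if_false, add_zero]
    rw [← Finset.sum_sub_distrib]
    exact Finset.sum_congr rfl fun y _ => by ring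

/-- On every light rectangle, the value of a protocol is bounded by the potential and the number of
communicated bits. -/
theorem sum_value_le_potential {O : Type} {r : K × B × B → K × B × B → Prop}
    (hsymm : ∀ u v, r u v → r v u) {T h s β L : ℝ} (hrow : RowBounded r T)
    (hcol : RowBounded (swapRel r) T) (hT : 0 ≤ T) (hh : 0 < h) (hhB : 1 ≤ Fintype.card B * h)
    (hs : 0 < s) (hβ : 0 ≤ β) (hL : 1 + L ≤ Real.log (Fintype.card B) + Real.log h)
    (hβL : β * L = 2 * s * (T * (Fintype.card B * h) * h) + 1 / s)
    {g : O → (K → B) → (K → B) → ℝ} (hg : ∀ o, IsClaim r (g o))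
    (P : Protocol (K → B) (K → B) O) :
    ∀ (X Y : Finset (K → B)) (A C : Finset K), IsFixed X A → IsFixed Y C → IsLight h X A →
      IsLight h Y C → ∑ x ∈ X, ∑ y ∈ Y, (g (P.output x y) x y - β * Real.log 2 * P.bits x y) ≤
        potential (relWeight r) β s h X Y A C := by
  have hc : 0 ≤ β * Real.log 2 := mul_nonneg hβ (Real.log_nonneg (by norm_num))
  have hτ0 : 0 ≤ T * (Fintype.card B * h) * h := by positivity
  have hle1 : ∀ (Q : Protocol (K → B) (K → B) O) (x y : K → B),
      g (Q.output x y) x y - β * Real.log 2 * Q.bits x y ≤ 1 := by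
    intro Q x y
    have h1 := ((hg (Q.output x y)).1 x y).2
    have h2 : 0 ≤ β * Real.log 2 * Q.bits x y := by positivity
    linarith
  induction P with
  | leaf o =>
    intro X Y A C hX hY hXl _
    simpa [Protocol.output, Protocol.bits] using
      (hg o).sum_le_potential hβ hs hh.le hX hY hXl
  | alice bit P Q ihP ihQ =>
    intro X Y A C hX hY hXl hYl
    have hτ : ∀ i j, i ≠ j → i ∉ C → ∀ x,
        ∑ y ∈ Y, relWeight r i j x y ≤ T * (Fintype.card B * h) * h * Y.card ∧
          ∑ y ∈ Y, relWeight r j i x y ≤ T * (Fintype.card B * h) * h * Y.card := by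
      intro i j hij hi x
      have := sum_relWeight_le hrow hT hh.le hhB hY hYl hij hi x
      refine ⟨this, ?_⟩
      simpa only [relWeight_comm hsymm j i] using this
    -- Alice's bit may destroy the lightness of her side only. `Y` is unchanged, so the bound `hτ`
    -- persists while lightness is restored.
    have rP := sum_le_potential_of_light (relWeight_nonneg r) hβ hs hh.le hτ0 hh hL hβL
      (hle1 P) hY hτ (fun X A hX hXl => ihP X Y A C hX hY hXl hYl)
      (X.filter fun x => ¬ bit x = true) A (hX.subset (Finset.filter_subset _ _))
    have rQ := sum_le_potential_of_light (relWeight_nonneg r) hβ hs hh.le hτ0 hh hL hβL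
      (hle1 Q) hY hτ (fun X A hX hXl => ihQ X Y A C hX hY hXl hYl)
      (X.filter fun x => bit x = true) A (hX.subset (Finset.filter_subset _ _))
    have hpot := potential_filter_add_le (relWeight r) (s := s) (η := h) hβ X Y A C
      fun x => bit x = true
    have hdec := sum_ite_sub_bits X Y bit (β * Real.log 2)
      (fun x y => g (P.output x y) x y) (fun x y => g (Q.output x y) x y)
      (fun x y => P.bits x y) (fun x y => Q.bits x y)
    have hval : ∑ x ∈ X, ∑ y ∈ Y, (g ((Protocol.alice bit P Q).output x y) x y -
        β * Real.log 2 * (Protocol.alice bit P Q).bits x y) =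
        ∑ x ∈ X, ∑ y ∈ Y, ((if bit x then g (Q.output x y) x y else g (P.output x y) x y) -
          β * Real.log 2 * ((if bit x then (Q.bits x y : ℝ) else P.bits x y) + 1)) := by
      refine Finset.sum_congr rfl fun x _ => Finset.sum_congr rfl fun y _ => ?_
      cases hb : bit x <;> simp [Protocol.output, Protocol.bits, hb]
    rw [hval, hdec]
    linarith
  | bob bit P Q ihP ihQ =>
    intro X Y A C hX hY hXl hYl
    have hτ : ∀ i j, i ≠ j → i ∉ A → ∀ y,
        ∑ x ∈ X, relWeight r i j x y ≤ T * (Fintype.card B * h) * h * X.card ∧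
          ∑ x ∈ X, relWeight r j i x y ≤ T * (Fintype.card B * h) * h * X.card := by
      intro i j hij hi y
      have := sum_relWeight_le hcol hT hh.le hhB hX hXl hij hi y
      have : ∑ x ∈ X, relWeight r i j x y ≤ T * (Fintype.card B * h) * h * X.card := this
      refine ⟨this, ?_⟩
      simpa only [relWeight_comm hsymm j i] using this
    have hwn : ∀ i j (y x : K → B), 0 ≤ (fun i j y x => relWeight r i j x y) i j y x :=
      fun i j y x => relWeight_nonneg r i j x y
    have rP := sum_le_potential_of_light (w := fun i j y x => relWeight r i j x y)
      (g := fun y x => g (P.output x y) x y - β * Real.log 2 * P.bits x y) hwn hβ hs hh.le hτ0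
      hh hL hβL (fun y x => hle1 P x y) hX hτ
      (fun Y C hY hYl => by
        rw [potential_swap, Finset.sum_comm]
        exact ihP X Y A C hX hY hXl hYl)
      (Y.filter fun y => ¬ bit y = true) C (hY.subset (Finset.filter_subset _ _))
    have rQ := sum_le_potential_of_light (w := fun i j y x => relWeight r i j x y)
      (g := fun y x => g (Q.output x y) x y - β * Real.log 2 * Q.bits x y) hwn hβ hs hh.le hτ0
      hh hL hβL (fun y x => hle1 Q x y) hX hτ
      (fun Y C hY hYl => by
        rw [potential_swap, Finset.sum_comm]
        exact ihQ X Y A C hX hY hXl hYl)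
      (Y.filter fun y => bit y = true) C (hY.subset (Finset.filter_subset _ _))
    have hpot := potential_filter_add_le (fun i j y x => relWeight r i j x y) (s := s) (η := h)
      hβ Y X C A fun y => bit y = true
    have hdec := sum_ite_sub_bits Y X bit (β * Real.log 2)
      (fun y x => g (P.output x y) x y) (fun y x => g (Q.output x y) x y)
      (fun y x => P.bits x y) (fun y x => Q.bits x y)
    have hval : ∑ x ∈ X, ∑ y ∈ Y, (g ((Protocol.bob bit P Q).output x y) x y -
        β * Real.log 2 * (Protocol.bob bit P Q).bits x y) =
        ∑ y ∈ Y, ∑ x ∈ X, ((if bit y then g (Q.output x y) x y else g (P.output x y) x y) -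
          β * Real.log 2 * ((if bit y then (Q.bits x y : ℝ) else P.bits x y) + 1)) := by
      rw [Finset.sum_comm]
      refine Finset.sum_congr rfl fun y _ => Finset.sum_congr rfl fun x _ => ?_
      cases hb : bit y <;> simp [Protocol.output, Protocol.bits, hb]
    rw [hval, hdec, ← potential_swap]
    linarith

end Search

/-! ### From deterministic protocols on random inputs to randomized protocols -/

section Randomized

variable {K B : Type} [Fintype K] [DecidableEq K] [Fintype B] [DecidableEq B]

lemma isFixed_empty [Nonempty B] (X : Finset (K → B)) : IsFixed X ∅ :=
  ⟨fun _ => Classical.arbitrary B, by simp⟩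

/-- Under the uniform distribution a partial assignment to `m` blocks has probability `|B| ^ (-m)`,
and `h` is at least `1 / |B|`. -/
lemma isLight_univ [Nonempty B] {h : ℝ} (hhB : 1 ≤ Fintype.card B * h) :
    IsLight h (Finset.univ : Finset (K → B)) ∅ := by
  intro S _ v
  have h1 := ((isFixed_empty (Finset.univ : Finset (K → B))).agreeing S v).card_le
  rw [Finset.empty_union] at h1
  have hB : (0 : ℝ) < Fintype.card B := by exact_mod_cast Fintype.card_pos
  have hh : 0 < h := by
    by_contra hneg
    have := mul_nonpos_of_nonneg_of_nonpos hB.le (not_lt.1 hneg)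
    linarith
  calc ((agreeing Finset.univ S v).card : ℝ)
      ≤ (Fintype.card B : ℝ) ^ (Fintype.card K - S.card) := by exact_mod_cast h1
    _ ≤ (Fintype.card B * h) ^ S.card * (Fintype.card B : ℝ) ^ (Fintype.card K - S.card) :=
        le_mul_of_one_le_left (by positivity) (one_le_pow₀ hhB)
    _ = h ^ S.card *
          ((Fintype.card B : ℝ) ^ S.card * (Fintype.card B : ℝ) ^ (Fintype.card K - S.card)) := by
        rw [mul_pow]; ring
    _ = h ^ S.card * (Finset.univ : Finset (K → B)).card := by
        rw [← pow_add, Nat.add_sub_cancel' (Finset.card_le_univ S)]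
        simp

lemma deficit_univ : deficit (Finset.univ : Finset (K → B)) ∅ = 0 := by
  simp [deficit]

/-- The expected value of a deterministic protocol on uniformly random inputs. -/
theorem sum_value_le [Nonempty B] {O : Type} {r : K × B × B → K × B × B → Prop}
    (hsymm : ∀ u v, r u v → r v u) {T h s β L : ℝ} (hrow : RowBounded r T)
    (hcol : RowBounded (swapRel r) T) (hT : 0 ≤ T) (hh : 0 < h) (hhB : 1 ≤ Fintype.card B * h)
    (hs : 0 < s) (hβ : 0 ≤ β) (hL : 1 + L ≤ Real.log (Fintype.card B) + Real.log h)
    (hβL : β * L = 2 * s * (T * (Fintype.card B * h) * h) + 1 / s)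
    {g : O → (K → B) → (K → B) → ℝ} (hg : ∀ o, IsClaim r (g o))
    (P : Protocol (K → B) (K → B) O) {d : ℝ} (hd : ∀ x y, (P.bits x y : ℝ) ≤ d) :
    ∑ x, ∑ y, g (P.output x y) x y ≤
      ∑ _x : K → B, ∑ _y : K → B, (h + β * Real.log 2 * d) := by
  have hmain := sum_value_le_potential hsymm hrow hcol hT hh hhB hs hβ hL hβL hg P
    Finset.univ Finset.univ ∅ ∅ (isFixed_empty _) (isFixed_empty _) (isLight_univ hhB)
    (isLight_univ hhB)
  have hpot : potential (relWeight r) β s h Finset.univ Finset.univ ∅ ∅ =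
      ∑ x : K → B, ∑ y : K → B, h := by
    simp [potential, deficit_univ, pairWeight]
    ring
  rw [hpot] at hmain
  have hbits : ∑ x, ∑ y, β * Real.log 2 * (P.bits x y : ℝ) ≤
      ∑ x : K → B, ∑ y : K → B, β * Real.log 2 * d := by
    refine Finset.sum_le_sum fun x _ => Finset.sum_le_sum fun y _ => ?_
    exact mul_le_mul_of_nonneg_left (hd x y)
      (mul_nonneg hβ (Real.log_nonneg (by norm_num)))
  simp only [Finset.sum_sub_distrib, Finset.sum_add_distrib] at hmain ⊢
  linarith

open scoped Classical in
/-- If no deterministic protocol in the support of a randomized protocol solves a search problem with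
probability greater than `M` on uniformly random inputs, then the randomized protocol does not solve
it with success probability greater than `M`. -/
lemma RandomizedProtocol.Solves.le_of_forall_sum_le {X Y O : Type} [Fintype X] [Fintype Y]
    [Nonempty X] [Nonempty Y] {R : RandomizedProtocol X Y O} {S : X → Y → O → Prop} {δ M : ℝ}
    (hM : 0 ≤ M) (hR : R.Solves S δ)
    (h : ∀ P ∈ R.support, ∑ x, ∑ y, (if S x y (P.output x y) then (1 : ℝ) else 0) ≤
      ∑ _x : X, ∑ _y : Y, M) : δ ≤ M := by
  have h' : ∀ P ∈ R.support, ∑ x, ∑ y, (if S x y (P.output x y) then (1 : ℝ≥0∞) else 0) ≤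
      ∑ x : X, ∑ y : Y, ENNReal.ofReal M := by
    intro P hP
    have := ENNReal.ofReal_le_ofReal (h P hP)
    rw [ENNReal.ofReal_sum_of_nonneg (fun x _ => Finset.sum_nonneg fun y _ => by
        split_ifs <;> norm_num),
      ENNReal.ofReal_sum_of_nonneg (fun x _ => Finset.sum_nonneg fun y _ => hM)] at this
    convert this using 2 with x _ x _
    · rw [ENNReal.ofReal_sum_of_nonneg (fun y _ => by split_ifs <;> norm_num)]
      refine Finset.sum_congr rfl fun y _ => ?_
      split_ifs <;> simp
    · rw [ENNReal.ofReal_sum_of_nonneg (fun y _ => hM)]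
  -- The easy direction of Yao's principle: sum the success probability over all inputs and exchange
  -- this with the sum over protocols.
  have hkey : ∑ x : X, ∑ y : Y, ENNReal.ofReal δ ≤ ∑ x : X, ∑ y : Y, ENNReal.ofReal M := by
    calc ∑ x : X, ∑ y : Y, ENNReal.ofReal δ
        ≤ ∑ x : X, ∑ y : Y, ∑' P, R P * (if S x y (P.output x y) then (1 : ℝ≥0∞) else 0) := by
          refine Finset.sum_le_sum fun x _ => Finset.sum_le_sum fun y _ => (hR x y).trans ?_
          rw [PMF.toOuterMeasure_apply]
          refine ENNReal.tsum_le_tsum fun P => ?_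
          by_cases hS : S x y (P.output x y) <;> simp [Set.indicator, hS]
      _ = ∑' P, R P * ∑ x, ∑ y, (if S x y (P.output x y) then (1 : ℝ≥0∞) else 0) := by
          simp only [Finset.mul_sum]
          rw [Summable.tsum_finsetSum fun _ _ => ENNReal.summable]
          refine Finset.sum_congr rfl fun x _ => ?_
          rw [Summable.tsum_finsetSum fun _ _ => ENNReal.summable]
      _ ≤ ∑' P, R P * ∑ x : X, ∑ y : Y, ENNReal.ofReal M := by
          refine ENNReal.tsum_le_tsum fun P => ?_
          by_cases hP : P ∈ R.support
          · exact mul_le_mul_right (h' P hP) _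
          · rw [PMF.mem_support_iff, not_not] at hP
            simp [hP]
      _ = ∑ x : X, ∑ y : Y, ENNReal.ofReal M := by
          rw [ENNReal.tsum_mul_right, PMF.tsum_coe, one_mul]
  by_contra hlt
  have hlt' : ENNReal.ofReal M < ENNReal.ofReal δ :=
    (ENNReal.ofReal_lt_ofReal_iff (by linarith)).2 (not_le.1 hlt)
  refine absurd hkey (not_le.2 ?_)
  have hne : ∀ {ι : Type} [Fintype ι] [Nonempty ι] {a b : ℝ≥0∞}, a < b → b ≠ ⊤ →
      ∑ _x : ι, a < ∑ _x : ι, b := by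
    intro ι _ _ a b hab hb
    simp only [Finset.sum_const, nsmul_eq_mul]
    refine ENNReal.mul_lt_mul_right (by simp) (by simp) hab
  exact hne (hne hlt' ENNReal.ofReal_ne_top) (by simp [ENNReal.mul_eq_top])

end Randomized

/-! ### The search problem of a graph -/

section Clique

variable {k t : ℕ}

/-- The vertex of a block graph that is described by its two halves. -/
def halvesVertex (u : Fin k × (Fin t → Bool) × (Fin t → Bool)) : BlockVertex k (t + t) :=
  (u.1, Fin.append u.2.1 u.2.2)

lemma halvesVertex_injective : Function.Injective (halvesVertex (k := k) (t := t)) := by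
  rintro ⟨i, a, b⟩ ⟨j, a', b'⟩ h
  simp only [halvesVertex, Prod.mk.injEq] at h
  obtain ⟨rfl, h⟩ := h
  have := (Fin.appendEquiv t t).injective (a₁ := (a, b)) (a₂ := (a', b')) h
  simpa using this

lemma halvesVertex_surjective : Function.Surjective (halvesVertex (k := k) (t := t)) := by
  rintro ⟨i, w⟩
  obtain ⟨⟨a, b⟩, h⟩ := (Fin.appendEquiv t t).surjective w
  exact ⟨(i, a, b), Prod.ext rfl h⟩

/-- Two vertices from distinct blocks are not joined by an edge of `G`. -/
def nonEdge (G : SimpleGraph (BlockVertex k (t + t)))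
    (u v : Fin k × (Fin t → Bool) × (Fin t → Bool)) : Prop :=
  u.1 ≠ v.1 ∧ ¬ G.Adj (halvesVertex u) (halvesVertex v)

lemma nonEdge_symm (G : SimpleGraph (BlockVertex k (t + t)))
    (u v : Fin k × (Fin t → Bool) × (Fin t → Bool)) (h : nonEdge G u v) : nonEdge G v u :=
  ⟨h.1.symm, fun hadj => h.2 hadj.symm⟩

/-- A falsified literal `x_{i,a} ≠ uₐ` reveals the bit `uₐ`, so a falsified axiom determines both
selected vertices. -/
lemma joinInputs_falsified_edgeAxiom {x y : HalfInput k t}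
    {u v : Fin k × (Fin t → Bool) × (Fin t → Bool)}
    (h : Clause.Falsified (edgeAxiom (halvesVertex u) (halvesVertex v)) (joinInputs x y)) :
    (u.1, x u.1, y u.1) = u ∧ (v.1, x v.1, y v.1) = v := by
  have key : ∀ w : Fin k × (Fin t → Bool) × (Fin t → Bool),
      (∀ a : Fin (t + t), neLit ((halvesVertex w).1, a) ((halvesVertex w).2 a) ∈
        edgeAxiom (halvesVertex u) (halvesVertex v)) → (w.1, x w.1, y w.1) = w := by
    intro w hw
    refine halvesVertex_injective ?_
    simp only [halvesVertex, Prod.mk.injEq, true_and]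
    funext a
    have := h _ (hw a)
    simpa [neLit, joinInputs, halvesVertex] using this
  refine ⟨key u fun a => ?_, key v fun a => ?_⟩ <;> simp [edgeAxiom]

open scoped Classical in
lemma isClaim_cliqueSearch (G : SimpleGraph (BlockVertex k (t + t))) (C : blockCliqueFormula G) :
    IsClaim (nonEdge G) fun x y => if cliqueSearch G x y C then (1 : ℝ) else 0 := by
  obtain ⟨C, u, v, huv, hadj, rfl⟩ := C
  obtain ⟨u, rfl⟩ := halvesVertex_surjective u
  obtain ⟨v, rfl⟩ := halvesVertex_surjective v
  refine ⟨fun x y => by dsimp only; split_ifs <;> norm_num, u, v, huv, ⟨huv, hadj⟩, fun x y hxy => ?_⟩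
  exact joinInputs_falsified_edgeAxiom (by_contra fun hC => hxy (if_neg hC))

/-- The lower bound for graphs in which no vertex has many non-neighbors in a row or a column. -/
theorem cliqueSearchCostAtLeast_of_rowBounded (G : SimpleGraph (BlockVertex k (t + t)))
    {T h s β L δ b : ℝ} (hrow : RowBounded (nonEdge G) T)
    (hcol : RowBounded (swapRel (nonEdge G)) T) (hT : 0 ≤ T) (hh : 0 < h)
    (hhB : 1 ≤ (2 : ℝ) ^ t * h) (hs : 0 < s) (hβ : 0 ≤ β)
    (hL : 1 + L ≤ Real.log ((2 : ℝ) ^ t) + Real.log h)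
    (hβL : β * L = 2 * s * (T * ((2 : ℝ) ^ t * h) * h) + 1 / s) (hb : 0 ≤ b)
    (hδ : h + β * Real.log 2 * b < δ) :
    CliqueSearchCostAtLeast G δ (ENNReal.ofReal b) := by
  classical
  intro R hR
  by_contra hcost
  rw [not_le] at hcost
  have hcard : (Fintype.card (Fin t → Bool) : ℝ) = 2 ^ t := by simp
  rw [← hcard] at hhB hL hβL
  refine absurd (hR.le_of_forall_sum_le (M := h + β * Real.log 2 * b) ?_ fun P hP => ?_)
    (not_le.2 hδ)
  · have := Real.log_nonneg (x := 2) (by norm_num)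
    positivity
  · refine sum_value_le (nonEdge_symm G) hrow hcol hT hh hhB hs hβ hL hβL
      (g := fun C x y => if cliqueSearch G x y C then (1 : ℝ) else 0)
      (isClaim_cliqueSearch G) P fun x y => ?_
    have h1 : (P.bits x y : ℕ∞) ≤ R.cost :=
      ((le_iSup (fun y => (P.bits x y : ℕ∞)) y).trans
        (le_iSup (fun x => ⨆ y, (P.bits x y : ℕ∞)) x)).trans (le_iSup₂_of_le P hP le_rfl)
    have h2 : ((P.bits x y : ℕ∞) : ℝ≥0∞) ≤ (R.cost : ℝ≥0∞) := ENat.toENNReal_le.2 h1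
    have h3 := h2.trans_lt hcost
    rw [ENat.toENNReal_coe, ← ENNReal.ofReal_natCast] at h3
    exact ((ENNReal.ofReal_lt_ofReal_iff_of_nonneg (Nat.cast_nonneg _)).1 h3).le

end Clique

/-! ### Non-edges of random graphs -/

section RandomGraph

lemma measurableSet_simpleGraph {V : Type} [Finite V] (S : Set (SimpleGraph V)) :
    MeasurableSet S := by
  rw [← Set.preimage_image_eq S SimpleGraph.edgeSet_injective]
  exact SimpleGraph.measurable_edgeSet (Set.toFinite _).measurableSet

lemma binomialRandom_forall_notMem_edgeSet {V : Type} [Finite V] (p : unitInterval)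
    (F : Finset (Sym2 V)) (hF : ∀ e ∈ F, ¬ e.IsDiag) :
    (SimpleGraph.binomialRandom V p).real {G | ∀ e ∈ F, e ∉ G.edgeSet} =
      (1 - (p : ℝ)) ^ F.card := by
  rw [measureReal_def, SimpleGraph.binomialRandom_eq_map,
    Measure.map_apply SimpleGraph.measurable_fromEdgeSet (measurableSet_simpleGraph _)]
  have hpre : SimpleGraph.fromEdgeSet ⁻¹' {G : SimpleGraph V | ∀ e ∈ F, e ∉ G.edgeSet} =
      {s : Set (Sym2 V) | ∀ e ∈ F, e ∉ s} := by
    ext s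
    simp only [Set.mem_preimage, Set.mem_ofPred_eq, SimpleGraph.edgeSet_fromEdgeSet]
    refine forall₂_congr fun e he => not_congr ⟨fun h => h.1, fun h => ⟨h, ?_⟩⟩
    exact hF e he
  rw [hpre, ProbabilityTheory.setBernoulli_apply']
  -- Avoiding `F` is a cylinder event of the product measure, so its probability factors.
  have hpi : (fun q : Sym2 V → Prop => {e | q e}) ⁻¹' {s : Set (Sym2 V) | ∀ e ∈ F, e ∉ s} =
      (F : Set (Sym2 V)).pi fun _ => {False} := by
    ext q
    simp [Set.mem_pi]
  rw [hpi, Measure.infinitePi_pi _ fun _ _ => MeasurableSet.of_discrete,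
    Finset.prod_congr rfl (g := fun _ => ((unitInterval.toNNReal (unitInterval.symm p) : NNReal) :
      ℝ≥0∞))]
  · simp
  · intro e he
    have := hF e he
    simp [this]

/-- Since `e ^ 2 ≤ 8`, one has `(e ^ 2 a) ^ m / m! ≤ m ^ m / m! ≤ e ^ m`; divide by `e ^ (2m)`. -/
lemma pow_div_factorial_le_exp_neg {a : ℝ} {m : ℕ} (ha : 0 ≤ a) (ham : 8 * a ≤ m) :
    a ^ m / m.factorial ≤ Real.exp (-m) := by
  have he : Real.exp 2 ≤ 8 := by
    have h1 := Real.exp_one_lt_d9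
    have h2 : Real.exp 2 = Real.exp 1 * Real.exp 1 := by rw [← Real.exp_add]; norm_num
    rw [h2]
    nlinarith [Real.exp_pos 1]
  have h1 : (Real.exp 2 * a) ^ m / m.factorial ≤ Real.exp m := by
    refine le_trans ?_ (Real.pow_div_factorial_le_exp m (Nat.cast_nonneg m) m)
    have : Real.exp 2 * a ≤ m := (mul_le_mul_of_nonneg_right he ha).trans ham
    gcongr
  have h2 : (Real.exp 2) ^ m = Real.exp m * Real.exp m := by
    rw [← Real.exp_nat_mul, ← Real.exp_add]; ring_nf
  rw [mul_pow, h2] at h1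
  have h3 : Real.exp (-m) * Real.exp m = 1 := by rw [← Real.exp_add]; simp
  calc a ^ m / m.factorial
      = (Real.exp (-m) * Real.exp m) * (Real.exp (-m) * Real.exp m) * (a ^ m / m.factorial) := by
        rw [h3]; ring
    _ = Real.exp (-m) * Real.exp (-m) * (Real.exp m * Real.exp m * a ^ m / m.factorial) := by ring
    _ ≤ Real.exp (-m) * Real.exp (-m) * Real.exp m := by gcongr
    _ = Real.exp (-m) := by rw [mul_assoc, h3, mul_one]

open scoped Classical in
/-- It is unlikely that many of the given pairs are non-edges. -/
lemma binomialRandom_lt_card_le {V ι : Type} [Finite V] [Fintype ι] (p : unitInterval)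
    {f : ι → Sym2 V} (hf : Function.Injective f) (hdiag : ∀ b, ¬ (f b).IsDiag) {T : ℝ}
    (hT : 8 * (Fintype.card ι * (1 - (p : ℝ))) ≤ T) :
    (SimpleGraph.binomialRandom V p).real
      {G | T < ((Finset.univ.filter fun b => f b ∉ G.edgeSet).card : ℝ)} ≤ Real.exp (-T) := by
  set m := ⌈T⌉₊
  have hTm : T ≤ m := Nat.le_ceil T
  have hq : 0 ≤ 1 - (p : ℝ) := by linarith [p.2.2]
  -- First moment bound: more than `T` non-edges contain a set of exactly `⌈T⌉₊` of them.
  have hsub : {G : SimpleGraph V | T < ((Finset.univ.filter fun b => f b ∉ G.edgeSet).card : ℝ)} ⊆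
      ⋃ F ∈ (Finset.univ : Finset ι).powersetCard m,
        {G | ∀ e ∈ F.image f, e ∉ G.edgeSet} := by
    intro G hG
    obtain ⟨F, hF, hFm⟩ := Finset.exists_subset_card_eq (Nat.ceil_le.2 (show T < _ from hG).le)
    simp only [Set.mem_iUnion, Finset.mem_powersetCard, exists_prop]
    refine ⟨F, ⟨Finset.subset_univ _, hFm⟩, fun e he => ?_⟩
    obtain ⟨b, hb, rfl⟩ := Finset.mem_image.1 he
    exact (Finset.mem_filter.1 (hF hb)).2
  calc _ ≤ (SimpleGraph.binomialRandom V p).real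
        (⋃ F ∈ (Finset.univ : Finset ι).powersetCard m, {G | ∀ e ∈ F.image f, e ∉ G.edgeSet}) :=
        measureReal_mono hsub (measure_ne_top _ _)
    _ ≤ ∑ F ∈ (Finset.univ : Finset ι).powersetCard m,
          (SimpleGraph.binomialRandom V p).real {G | ∀ e ∈ F.image f, e ∉ G.edgeSet} :=
        measureReal_biUnion_finset_le _ _
    _ = ∑ F ∈ (Finset.univ : Finset ι).powersetCard m, (1 - (p : ℝ)) ^ m := by
        refine Finset.sum_congr rfl fun F hF => ?_
        rw [binomialRandom_forall_notMem_edgeSet, Finset.card_image_of_injective _ hf,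
          (Finset.mem_powersetCard.1 hF).2]
        intro e he
        obtain ⟨b, _, rfl⟩ := Finset.mem_image.1 he
        exact hdiag b
    _ = ((Fintype.card ι).choose m : ℝ) * (1 - (p : ℝ)) ^ m := by
        rw [Finset.sum_const, Finset.card_powersetCard, nsmul_eq_mul, Finset.card_univ]
    _ ≤ (Fintype.card ι : ℝ) ^ m / m.factorial * (1 - (p : ℝ)) ^ m := by
        gcongr
        exact Nat.choose_le_pow_div m _
    _ = (Fintype.card ι * (1 - (p : ℝ))) ^ m / m.factorial := by rw [mul_pow]; ring
    _ ≤ Real.exp (-m) := pow_div_factorial_le_exp_neg (by positivity) (hT.trans hTm)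
    _ ≤ Real.exp (-T) := Real.exp_le_exp.2 (by linarith)

lemma measurable_inf_completeBlockGraph (k m : ℕ) :
    Measurable fun G : SimpleGraph (BlockVertex k m) => G ⊓ completeBlockGraph k m :=
  fun _ _ => measurableSet_simpleGraph _

instance isProbabilityMeasure_blockRandomGraph (k m : ℕ) (p : unitInterval) :
    IsProbabilityMeasure (blockRandomGraph k m p) :=
  Measure.isProbabilityMeasure_map (measurable_inf_completeBlockGraph k m).aemeasurable

variable {k t : ℕ}

open scoped Classical in
/-- It is unlikely that a fixed vertex has many non-neighbors among given vertices of another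
block. -/
lemma blockRandomGraph_lt_card_le (p : unitInterval)
    {f : (Fin t → Bool) → Fin k × (Fin t → Bool) × (Fin t → Bool)} (hf : Function.Injective f)
    {v : Fin k × (Fin t → Bool) × (Fin t → Bool)} (hv : ∀ b, (f b).1 ≠ v.1) {T : ℝ}
    (hT : 8 * (2 ^ t * (1 - (p : ℝ))) ≤ T) :
    (blockRandomGraph k (t + t) p).real
      {G | T < ((Finset.univ.filter fun b => nonEdge G (f b) v).card : ℝ)} ≤ Real.exp (-T) := by
  rw [blockRandomGraph, map_measureReal_apply (measurable_inf_completeBlockGraph k _)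
    (measurableSet_simpleGraph _)]
  have hne : ∀ b, halvesVertex (f b) ≠ halvesVertex v := fun b h =>
    hv b (by rw [halvesVertex_injective h])
  have hinj : Function.Injective fun b => s(halvesVertex (f b), halvesVertex v) := by
    intro b b' h
    rcases Sym2.eq_iff.1 h with h | h
    · exact hf (halvesVertex_injective h.1)
    · exact absurd h.1 (hne b)
  have := binomialRandom_lt_card_le p hinj (by simpa using hne) (T := T) (by simpa using hT)
  convert this using 3
  ext G
  simp only [Set.mem_preimage, Set.mem_ofPred_eq]
  have hset : (Finset.univ.filter fun b => nonEdge (G ⊓ completeBlockGraph k (t + t)) (f b) v) =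
      Finset.univ.filter fun b => s(halvesVertex (f b), halvesVertex v) ∉ G.edgeSet := by
    refine Finset.filter_congr fun b _ => ?_
    simp [nonEdge, completeBlockGraph, halvesVertex, hv b]
  rw [hset]

/-- In a random graph, with high probability all rows and columns contain few non-neighbors of every
vertex. -/
theorem blockRandomGraph_rowBounded (p : unitInterval) {T : ℝ}
    (hT : 8 * (2 ^ t * (1 - (p : ℝ))) ≤ T) :
    1 - 2 * ((k : ℝ) ^ 2 * (2 ^ t) ^ 3) * Real.exp (-T) ≤
      (blockRandomGraph k (t + t) p).real
        {G | RowBounded (nonEdge G) T ∧ RowBounded (swapRel (nonEdge G)) T} := by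
  classical
  set μ := blockRandomGraph k (t + t) p
  let J := (Fin k × Fin k) × (Fin t → Bool) × (Fin t → Bool) × (Fin t → Bool)
  let row : J → Set (SimpleGraph (BlockVertex k (t + t))) := fun c =>
    {G | c.1.1 ≠ c.1.2 ∧ T < ((Finset.univ.filter fun b =>
      nonEdge G (c.1.1, c.2.1, b) (c.1.2, c.2.2)).card : ℝ)}
  -- `swapRel` exchanges the halves of both vertices, hence the `swap` on the second one.
  let col : J → Set (SimpleGraph (BlockVertex k (t + t))) := fun c =>
    {G | c.1.1 ≠ c.1.2 ∧ T < ((Finset.univ.filter fun b =>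
      nonEdge G (c.1.1, b, c.2.1) (c.1.2, c.2.2.swap)).card : ℝ)}
  have hrow : ∀ c, μ.real (row c) ≤ Real.exp (-T) := by
    intro c
    by_cases hc : c.1.1 = c.1.2
    · simp [row, hc, Real.exp_nonneg]
    · refine (measureReal_mono (fun G hG => hG.2) (measure_ne_top _ _)).trans
        (blockRandomGraph_lt_card_le p (f := fun b => (c.1.1, c.2.1, b)) ?_ (fun _ => hc) hT)
      intro b b' h
      simpa using h
  have hcol : ∀ c, μ.real (col c) ≤ Real.exp (-T) := by
    intro c
    by_cases hc : c.1.1 = c.1.2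
    · simp [col, hc, Real.exp_nonneg]
    · refine (measureReal_mono (fun G hG => hG.2) (measure_ne_top _ _)).trans
        (blockRandomGraph_lt_card_le p (f := fun b => (c.1.1, b, c.2.1)) ?_ (fun _ => hc) hT)
      intro b b' h
      simpa using h
  have hJ : (Fintype.card J : ℝ) = (k : ℝ) ^ 2 * (2 ^ t) ^ 3 := by
    simp [J]; ring
  have hcover : {G | RowBounded (nonEdge G) T ∧ RowBounded (swapRel (nonEdge G)) T}ᶜ ⊆
      (⋃ c, row c) ∪ ⋃ c, col c := by
    intro G hG
    rw [Set.mem_compl_iff, Set.mem_ofPred_eq, not_and_or] at hG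
    rcases hG with hG | hG
    · left
      simp only [RowBounded, not_forall, not_le] at hG
      obtain ⟨i, j, hij, a, u, h⟩ := hG
      refine Set.mem_iUnion.2 ⟨((i, j), a, u), hij, h⟩
    · right
      simp only [RowBounded, not_forall, not_le] at hG
      obtain ⟨i, j, hij, a, u, h⟩ := hG
      refine Set.mem_iUnion.2 ⟨((i, j), a, u), hij, h⟩
  have hunion : ∀ s : J → Set (SimpleGraph (BlockVertex k (t + t))),
      (∀ c, μ.real (s c) ≤ Real.exp (-T)) →
      μ.real (⋃ c, s c) ≤ (k : ℝ) ^ 2 * (2 ^ t) ^ 3 * Real.exp (-T) := by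
    intro s hs
    refine (measureReal_iUnion_fintype_le _).trans ?_
    refine (Finset.sum_le_card_nsmul _ _ _ fun c _ => hs c).trans ?_
    rw [nsmul_eq_mul, Finset.card_univ, hJ]
  have hcompl := (measureReal_mono hcover (measure_ne_top μ _)).trans
    (measureReal_union_le (μ := μ) (⋃ c, row c) (⋃ c, col c))
  rw [probReal_compl_eq_one_sub (measurableSet_simpleGraph _)] at hcompl
  have := hunion row hrow
  have := hunion col hcol
  linarith

end RandomGraph

/-! ### The choice of the parameters -/

section Parameters

variable {k t : ℕ}

/-- Balances the parameters. The two hypotheses on `b` control the parts of `b ^ 2 τ` that come from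
the mean `8 N q` and from the deviation `4 ℓ` in the row bound. -/
lemma cliqueSearchCostAtLeast_of_le (G : SimpleGraph (BlockVertex k (t + t)))
    {δ b q ℓ N : ℝ} (hN : N = 2 ^ t) (hδ : 0 < δ) (hq : 0 ≤ q) (hℓ : 1 ≤ ℓ)
    (hrow : RowBounded (nonEdge G) (8 * (N * q) + 4 * ℓ))
    (hcol : RowBounded (swapRel (nonEdge G)) (8 * (N * q) + 4 * ℓ)) (hb : 0 ≤ b)
    (hbq : b ^ 2 * (N ^ (0.1 : ℝ) * q) ≤ (δ / 20) ^ 2)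
    (hbℓ : b * ℓ ≤ δ / 20 * N ^ (0.45 : ℝ)) (hN1 : 40 ≤ Real.log N)
    (hNδ : N ^ (-0.95 : ℝ) < δ / 2) :
    CliqueSearchCostAtLeast G δ (ENNReal.ofReal b) := by
  -- The threshold `s` below is proportional to `b` and has to be positive.
  rcases hb.eq_or_lt with rfl | hb
  · intro R _; simp
  have hN0 : 0 < N := by rw [hN]; positivity
  have hN1' : 1 ≤ N := by rw [hN]; exact one_le_pow₀ (by norm_num)
  set L : ℝ := 0.05 * Real.log N - 1 with hL
  have hL1 : 1 ≤ L := by rw [hL]; linarith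
  -- This exceeds the uniform probability by a factor `N ^ 0.05`, whose logarithm is exactly `1 +
  -- L`.
  set h : ℝ := N ^ (-0.95 : ℝ) with hh
  have hh0 : 0 < h := Real.rpow_pos_of_pos hN0 _
  have hNh : N * h = N ^ (0.05 : ℝ) := by
    rw [hh, ← Real.rpow_one_add' hN0.le (by norm_num)]; norm_num
  have hNhh : N * h * h = N ^ (-0.9 : ℝ) := by
    rw [hNh, hh, ← Real.rpow_add hN0]; norm_num
  set T : ℝ := 8 * (N * q) + 4 * ℓ with hT
  have hT0 : 0 ≤ T := by positivity
  -- Chosen so that the `1 / s` part of `β` contributes exactly `δ / 4` to `β b`.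
  set s : ℝ := 4 * b / (δ * L) with hs
  have hs0 : 0 < s := by positivity
  set τ : ℝ := T * (N * h) * h with hτ
  have hτ0 : 0 ≤ τ := by positivity
  have hbτ : b ^ 2 * τ ≤ 12 * (δ / 20) ^ 2 := by
    have h1 : N * (N * h * h) = N ^ (0.1 : ℝ) := by
      rw [hNhh, ← Real.rpow_one_add' hN0.le (by norm_num)]; norm_num
    have h2 : b ^ 2 * ℓ * (N * h * h) ≤ (δ / 20) ^ 2 := by
      have h3 : (b * ℓ) ^ 2 ≤ (δ / 20 * N ^ (0.45 : ℝ)) ^ 2 := by gcongr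
      have h4 : (N ^ (0.45 : ℝ)) ^ 2 * (N * h * h) = 1 := by
        rw [hNhh, ← Real.rpow_natCast, ← Real.rpow_mul hN0.le, ← Real.rpow_add hN0]; norm_num
      have h5 : 0 ≤ N * h * h := by positivity
      calc b ^ 2 * ℓ * (N * h * h) = b ^ 2 * (ℓ * 1) * (N * h * h) := by ring
        _ ≤ b ^ 2 * (ℓ * ℓ) * (N * h * h) := by gcongr
        _ = (b * ℓ) ^ 2 * (N * h * h) := by ring
        _ ≤ (δ / 20 * N ^ (0.45 : ℝ)) ^ 2 * (N * h * h) := by gcongr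
        _ = (δ / 20) ^ 2 * ((N ^ (0.45 : ℝ)) ^ 2 * (N * h * h)) := by ring
        _ = (δ / 20) ^ 2 := by rw [h4, mul_one]
    calc b ^ 2 * τ = 8 * (b ^ 2 * (N * (N * h * h) * q)) + 4 * (b ^ 2 * ℓ * (N * h * h)) := by
          rw [hτ, hT]; ring
      _ ≤ 8 * (δ / 20) ^ 2 + 4 * (δ / 20) ^ 2 := by rw [h1]; gcongr
      _ = 12 * (δ / 20) ^ 2 := by ring
  set β : ℝ := (2 * s * τ + 1 / s) / L with hβ
  have hβ0 : 0 ≤ β := by positivity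
  refine cliqueSearchCostAtLeast_of_rowBounded G (T := T) (h := h) (s := s) (β := β) (L := L)
    hrow hcol hT0 hh0 ?_ hs0 hβ0 ?_ ?_ hb.le ?_
  · rw [← hN, hNh]
    exact Real.one_le_rpow hN1' (by norm_num)
  · rw [← hN, hh, Real.log_rpow hN0, hL]
    apply le_of_eq; ring
  · rw [← hN, hβ]
    field_simp
    rw [hτ]; ring
  · have hlog : Real.log 2 ≤ 1 := by
      have := Real.log_two_lt_d9
      linarith
    have h1 : β * b = 8 * (b ^ 2 * τ) / δ / L ^ 2 + δ / 4 := by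
      rw [hβ, hs]
      field_simp
      ring
    have h2 : 8 * (b ^ 2 * τ) / δ / L ^ 2 ≤ 8 * (12 * (δ / 20) ^ 2) / δ := by
      calc 8 * (b ^ 2 * τ) / δ / L ^ 2 ≤ 8 * (b ^ 2 * τ) / δ :=
            div_le_self (by positivity) (one_le_pow₀ hL1)
        _ ≤ 8 * (12 * (δ / 20) ^ 2) / δ := by gcongr
    have h3 : 8 * (12 * (δ / 20) ^ 2) / δ = 0.24 * δ := by field_simp; norm_num
    have h4 : β * Real.log 2 * b ≤ β * 1 * b := by gcongr
    -- The error is below `0.5 δ + 0.24 δ + 0.25 δ`, which is less than `δ`.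
    linarith

/-- The lower bound of the theorem is a real number. -/
lemma exists_ofReal_eq_mul_min {c D A : ℝ} (hc : 0 < c) (hD : 0 ≤ D) (hA : 0 ≤ A) :
    ∃ b : ℝ, 0 ≤ b ∧ b * D ≤ c ∧ b ≤ c * A ∧
      ENNReal.ofReal c * min (1 / ENNReal.ofReal D) (ENNReal.ofReal A) = ENNReal.ofReal b := by
  -- For `D = 0`, that is `p = 1`, the first term of the minimum is `⊤`.
  rcases hD.eq_or_lt with rfl | hD
  · refine ⟨c * A, by positivity, by simpa using hc.le, le_rfl, ?_⟩
    simp [ENNReal.ofReal_mul hc.le]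
  · refine ⟨c * min (1 / D) A, by positivity, ?_, ?_, ?_⟩
    · calc c * min (1 / D) A * D ≤ c * (1 / D) * D := by gcongr; exact min_le_left _ _
        _ = c := by field_simp
    · gcongr; exact min_le_right _ _
    · rw [ENNReal.ofReal_mul hc.le, ENNReal.ofReal_min, ENNReal.ofReal_div_of_pos hD,
        ENNReal.ofReal_one]

/-- The lower bound, for explicit block sizes. -/
theorem one_sub_le_blockRandomGraph_real {δ ε : ℝ} (hδ : 0 < δ) {n : ℕ} (hn : n = 2 ^ (t + t))
    (hk : 1 ≤ k) (p : unitInterval) (hlog : 80 ≤ Real.log n)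
    (hnδ : (n : ℝ) ^ (-0.475 : ℝ) < δ / 2) (hnε : 2 / (n : ℝ) ≤ ε) :
    1 - ε ≤ (blockRandomGraph k (t + t) p).real
      {G | CliqueSearchCostAtLeast G δ
        (ENNReal.ofReal (δ / 20) *
          min (1 / ENNReal.ofReal (Real.sqrt ((n : ℝ) ^ (0.05 : ℝ) * (1 - (p : ℝ)))))
            (ENNReal.ofReal ((n : ℝ) ^ (0.225 : ℝ) / Real.log ((k : ℝ) * (n : ℝ)))))} := by
  have hq : 0 ≤ 1 - (p : ℝ) := by linarith [p.2.2]
  set N : ℝ := 2 ^ t with hN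
  have hN1 : 1 ≤ N := one_le_pow₀ (by norm_num)
  have hN0 : 0 < N := by linarith
  have hnN : (n : ℝ) = N ^ (2 : ℝ) := by
    rw [hn, hN, pow_add, Nat.cast_mul]; norm_num; ring
  have hnN2 : (n : ℝ) = N ^ 2 := by rw [hnN]; norm_num
  have hn1 : (1 : ℝ) ≤ n := by rw [hnN2]; exact one_le_pow₀ hN1
  have hk1 : (1 : ℝ) ≤ k := by exact_mod_cast hk
  have hkn : (n : ℝ) ≤ k * n := le_mul_of_one_le_left (by linarith) hk1
  set ℓ : ℝ := Real.log ((k : ℝ) * n) with hℓ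
  have hℓ1 : 1 ≤ ℓ := by
    have := Real.log_le_log (by linarith) hkn
    linarith
  set A : ℝ := (n : ℝ) ^ (0.225 : ℝ) / ℓ with hA
  have hA0 : 0 ≤ A := by positivity
  obtain ⟨b, hb0, hbD, hbA, hb⟩ := exists_ofReal_eq_mul_min (c := δ / 20) (by positivity)
    (Real.sqrt_nonneg ((n : ℝ) ^ (0.05 : ℝ) * (1 - (p : ℝ)))) hA0
  rw [hb]
  have hprob := blockRandomGraph_rowBounded (k := k) (t := t) p
    (T := 8 * (N * (1 - (p : ℝ))) + 4 * ℓ) (by linarith)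
  refine le_trans ?_ (hprob.trans (measureReal_mono (fun G hG => ?_) (measure_ne_top _ _)))
  · have hexp : Real.exp (-(8 * (N * (1 - (p : ℝ))) + 4 * ℓ)) ≤ 1 / ((k : ℝ) * n) ^ 4 := by
      calc Real.exp (-(8 * (N * (1 - (p : ℝ))) + 4 * ℓ)) ≤ Real.exp (-((4 : ℕ) * ℓ)) := by
            refine Real.exp_le_exp.2 ?_
            have : 0 ≤ N * (1 - (p : ℝ)) := by positivity
            push_cast; linarith
        _ = 1 / ((k : ℝ) * n) ^ 4 := by
            rw [Real.exp_neg, Real.exp_nat_mul, hℓ, Real.exp_log (by positivity), one_div]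
    have hN3 : N ^ 3 ≤ (n : ℝ) ^ 2 := by
      rw [hnN2, ← pow_mul N]; exact pow_le_pow_right₀ hN1 (by norm_num : 3 ≤ 2 * 2)
    have hsmall : 2 * ((k : ℝ) ^ 2 * N ^ 3) * Real.exp (-(8 * (N * (1 - (p : ℝ))) + 4 * ℓ)) ≤
        2 / n := by
      calc _ ≤ 2 * ((k : ℝ) ^ 2 * (n : ℝ) ^ 2) * (1 / ((k : ℝ) * n) ^ 4) := by gcongr
        _ = 2 / ((k : ℝ) * n) ^ 2 := by field_simp
        _ ≤ 2 / n := div_le_div_of_nonneg_left (by norm_num) (by linarith)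
            (hkn.trans (le_self_pow₀ (hn1.trans hkn) (by norm_num)))
    linarith
  · refine cliqueSearchCostAtLeast_of_le G hN hδ hq hℓ1 hG.1 hG.2 hb0 ?_ ?_ ?_ ?_
    · have h1 : N ^ (0.1 : ℝ) = (n : ℝ) ^ (0.05 : ℝ) := by
        rw [hnN, ← Real.rpow_mul hN0.le]; norm_num
      rw [h1, ← Real.sq_sqrt (x := (n : ℝ) ^ (0.05 : ℝ) * (1 - (p : ℝ))) (by positivity), ← mul_pow]
      gcongr
    · have h1 : N ^ (0.45 : ℝ) = (n : ℝ) ^ (0.225 : ℝ) := by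
        rw [hnN, ← Real.rpow_mul hN0.le]; norm_num
      calc b * ℓ ≤ δ / 20 * A * ℓ := by gcongr
        _ = δ / 20 * N ^ (0.45 : ℝ) := by rw [h1, hA]; field_simp
    · rw [hnN2, Real.log_pow] at hlog
      push_cast at hlog
      linarith
    · rw [hnN, ← Real.rpow_mul hN0.le] at hnδ
      convert hnδ using 2
      norm_num

/-- Both terms of the minimum are at least `n ^ 0.1 / 20`: the first since `0.05 - 1/3 ≤ -0.2`, the
second since `log (n ^ 2) ≤ 20 n ^ 0.1` and `0.2 ≤ 0.225`. The spare factor `n ^ 0.08` absorbs `c`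
and the `20`. -/
lemma ofReal_rpow_le_mul_min {c : ℝ} (hc : 0 < c) {n : ℕ} (hn : 2 ≤ n)
    (hcn : 20 ≤ c * (n : ℝ) ^ (0.08 : ℝ)) {p : ℝ} (hp : p = 1 - (n : ℝ) ^ (-(1 / 3) : ℝ)) :
    ENNReal.ofReal (((n * n : ℕ) : ℝ) ^ (0.01 : ℝ)) ≤ ENNReal.ofReal c *
      min (1 / ENNReal.ofReal (Real.sqrt ((n : ℝ) ^ (0.05 : ℝ) * (1 - p))))
        (ENNReal.ofReal ((n : ℝ) ^ (0.225 : ℝ) / Real.log ((n : ℝ) * (n : ℝ)))) := by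
  have hn2 : (2 : ℝ) ≤ n := by exact_mod_cast hn
  have hn1 : (1 : ℝ) ≤ n := by linarith
  have hn0 : (0 : ℝ) < n := by linarith
  have hlhs : ((n * n : ℕ) : ℝ) ^ (0.01 : ℝ) = (n : ℝ) ^ (0.02 : ℝ) := by
    rw [Nat.cast_mul, Real.mul_rpow hn0.le hn0.le, ← Real.rpow_add hn0]; norm_num
  have hsplit : (n : ℝ) ^ (0.1 : ℝ) = (n : ℝ) ^ (0.02 : ℝ) * (n : ℝ) ^ (0.08 : ℝ) := by
    rw [← Real.rpow_add hn0]; norm_num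
  have h02 : 0 < (n : ℝ) ^ (0.02 : ℝ) := Real.rpow_pos_of_pos hn0 _
  have h1 : (n : ℝ) ^ (0.02 : ℝ) ≤ c * ((n : ℝ) ^ (0.1 : ℝ) / 20) := by
    rw [hsplit]
    nlinarith
  have hsqrt : Real.sqrt ((n : ℝ) ^ (0.05 : ℝ) * (1 - p)) ≤ (n : ℝ) ^ (-0.1 : ℝ) := by
    rw [hp, sub_sub_cancel, ← Real.rpow_add hn0]
    refine Real.sqrt_le_iff.2 ⟨by positivity, ?_⟩
    rw [← Real.rpow_natCast, ← Real.rpow_mul hn0.le]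
    exact Real.rpow_le_rpow_of_exponent_le hn1 (by norm_num)
  rw [hlhs]
  calc ENNReal.ofReal ((n : ℝ) ^ (0.02 : ℝ))
      ≤ ENNReal.ofReal (c * ((n : ℝ) ^ (0.1 : ℝ) / 20)) := ENNReal.ofReal_le_ofReal h1
    _ = ENNReal.ofReal c * ENNReal.ofReal ((n : ℝ) ^ (0.1 : ℝ) / 20) := ENNReal.ofReal_mul hc.le
    _ ≤ _ := by
      refine mul_le_mul_right (le_min ?_ ?_) _
      · calc ENNReal.ofReal ((n : ℝ) ^ (0.1 : ℝ) / 20) ≤ ENNReal.ofReal ((n : ℝ) ^ (0.1 : ℝ)) :=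
              ENNReal.ofReal_le_ofReal (div_le_self (by positivity) (by norm_num))
          _ = 1 / ENNReal.ofReal ((n : ℝ) ^ (-0.1 : ℝ)) := by
              rw [← ENNReal.ofReal_one, ← ENNReal.ofReal_div_of_pos (by positivity), one_div,
                ← Real.rpow_neg hn0.le, neg_neg]
          _ ≤ _ := ENNReal.div_le_div_left (ENNReal.ofReal_le_ofReal hsqrt) _
      · refine ENNReal.ofReal_le_ofReal ?_
        have hlog : Real.log ((n : ℝ) * n) ≤ 20 * (n : ℝ) ^ (0.1 : ℝ) := by
          have := Real.log_le_rpow_div hn0.le (ε := 0.1) (by norm_num)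
          rw [Real.log_mul hn0.ne' hn0.ne']
          have h2 : (n : ℝ) ^ (0.1 : ℝ) / 0.1 = 10 * (n : ℝ) ^ (0.1 : ℝ) := by ring
          linarith
        have hlog0 : 0 < Real.log ((n : ℝ) * n) := Real.log_pos (by nlinarith)
        have h3 : (n : ℝ) ^ (0.1 : ℝ) * (n : ℝ) ^ (0.1 : ℝ) ≤ (n : ℝ) ^ (0.225 : ℝ) := by
          rw [← Real.rpow_add hn0]
          exact Real.rpow_le_rpow_of_exponent_le hn1 (by norm_num)
        have h4 : 0 < (n : ℝ) ^ (0.1 : ℝ) := Real.rpow_pos_of_pos hn0 _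
        rw [div_le_div_iff₀ (by norm_num) hlog0]
        nlinarith

end Parameters

end CliqueComm

end

theorem mainTheorem3 :
    -- the lower bound, for all block sizes `n = 2 ^ (t + t)`, all `k` and all `p`
    (∀ δ : ℝ, 0 < δ → ∃ c : ℝ, 0 < c ∧ ∀ ε : ℝ, 0 < ε →
      ∀ᶠ n : ℕ in atTop, ∀ t k : ℕ, n = 2 ^ (t + t) → 1 ≤ k → ∀ p : unitInterval,
        1 - ε ≤ (CliqueComm.blockRandomGraph k (t + t) p).real
          {G | CliqueComm.CliqueSearchCostAtLeast G δ
            (ENNReal.ofReal c *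
              min (1 / ENNReal.ofReal (Real.sqrt ((n : ℝ) ^ (0.05 : ℝ) * (1 - (p : ℝ)))))
                (ENNReal.ofReal ((n : ℝ) ^ (0.225 : ℝ) / Real.log ((k : ℝ) * (n : ℝ)))))}) ∧
    -- the case `k = n`, `p = 1 - n ^ (-1/3)`, where the graph has `N = n * n` vertices
    (∃ γ : ℝ, 0 < γ ∧ ∀ δ : ℝ, 0 < δ → ∀ ε : ℝ, 0 < ε →
      ∀ᶠ n : ℕ in atTop, ∀ t : ℕ, n = 2 ^ (t + t) →
        ∀ p : unitInterval, (p : ℝ) = 1 - (n : ℝ) ^ (-(1 / 3) : ℝ) →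
          1 - ε ≤ (CliqueComm.blockRandomGraph n (t + t) p).real
            {G | CliqueComm.CliqueSearchCostAtLeast G δ
              (ENNReal.ofReal (((n * n : ℕ) : ℝ) ^ γ))}) := by
  have hreal : Tendsto (fun n : ℕ => (n : ℝ)) atTop atTop := tendsto_natCast_atTop_atTop
  have hpart : ∀ δ : ℝ, 0 < δ → ∀ ε : ℝ, 0 < ε →
      ∀ᶠ n : ℕ in atTop, ∀ t k : ℕ, n = 2 ^ (t + t) → 1 ≤ k → ∀ p : unitInterval,
        1 - ε ≤ (CliqueComm.blockRandomGraph k (t + t) p).real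
          {G | CliqueComm.CliqueSearchCostAtLeast G δ
            (ENNReal.ofReal (δ / 20) *
              min (1 / ENNReal.ofReal (Real.sqrt ((n : ℝ) ^ (0.05 : ℝ) * (1 - (p : ℝ)))))
                (ENNReal.ofReal ((n : ℝ) ^ (0.225 : ℝ) / Real.log ((k : ℝ) * (n : ℝ)))))} := by
    intro δ hδ ε hε
    have hlog := (Real.tendsto_log_atTop.comp hreal).eventually_ge_atTop 80
    have hpow := ((tendsto_rpow_neg_atTop (y := 0.475) (by norm_num)).comp hreal).eventually_lt_const
      (half_pos hδ)
    have hdiv := (tendsto_const_nhds (x := (2 : ℝ)).div_atTop hreal).eventually_le_const hε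
    filter_upwards [hlog, hpow, hdiv] with n h1 h2 h3 t k hn hk p
    exact CliqueComm.one_sub_le_blockRandomGraph_real hδ hn hk p h1 h2 h3
  refine ⟨fun δ hδ => ⟨δ / 20, by positivity, hpart δ hδ⟩, 0.01, by norm_num,
    fun δ hδ ε hε => ?_⟩
  have hlarge := ((tendsto_rpow_atTop (y := 0.08) (by norm_num)).comp hreal).const_mul_atTop
    (r := δ / 20) (by positivity) |>.eventually_ge_atTop 20
  filter_upwards [hpart δ hδ ε hε, hlarge, eventually_ge_atTop 2] with n hmain hn20 hn2 t hn p hp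
  refine (hmain t n hn (by omega) p).trans (measureReal_mono ?_ (measure_ne_top _ _))
  intro G hG R hR
  exact (CliqueComm.ofReal_rpow_le_mul_min (by positivity) hn2 hn20 hp).trans (hG R hR)
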